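/- Let $\mathbb{X},\mathbb{Y}$ be locally compact Polish spaces with locally finite positive Borel measures $\lambda,\nu$. Let $U:\mathbb{X}\to\mathbb{R}$, $V:\mathbb{Y}\to\mathbb{R}$ and a measurable $W:\mathbb{X}\times\mathbb{Y}\to\mathbb{R}$ be locally bounded, with $\sup e^{-W}<\infty$, and let all sub-level sets of $U$ and of $V$ be compact. Assume that $\mu(dx)=e^{-U(x)}\lambda(dx)$ and $\eta(dy)=e^{-V(y)}\nu(dy)$ are probability measures and that $K(x,dy)=e^{-W(x,y)}\nu(dy)$ is a Markov transition. Set $K^{\flat}(y,dx)=e^{-W(x,y)}\lambda(dx)$, $P(d(x,y))=\mu(dx)K(x,dy)$, $W^V(x)=\int W(x,y)\,\eta(dy)$ and $W_U(y)=\int W(x,y)\,\mu(dx)$. Let $\mathcal{B}_0(\mathbb{X})$ be the set of functions $\theta>0$ on $\mathbb{X}$ such that $1/\theta$ is locally bounded above, bounded below by a positive constant, and has compact sub-level sets; similarly $\mathcal{B}_0(\mathbb{Y})$. Condition (A). For some $\delta\in(0,1/2)$ one has $\int e^{-(1-2\delta)U}d\lambda<\infty$ and $\int e^{-(1-2\delta)V}d\nu<\infty$,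 and there are $\theta_u\in\mathcal{B}_0(\mathbb{X})$, $\theta_v\in\mathcal{B}_0(\mathbb{Y})$ with $e^{-(\delta U-W^V)}\le\theta_u$ and $e^{-(\delta V-W_U)}\le\theta_v$ everywhere (in particular $W^V$ and $W_U$ are finite). Fix such a $\delta$ and put $g=e^{\delta U}$, $h=e^{\delta V}$, and $\|f\|_g=\sup|f|/g$. For $a>0$ put $g_a=\frac12+a g$, $h_a=\frac12+a h$. Sinkhorn potentials: $(U_0,V_0)=(U,0)$ and, for $n\ge0$, $U_{2n+1}=U_{2n}$, $V_{2n+1}=V+\log K^{\flat}(e^{-U_{2n}})$, $U_{2n+2}=U+\log K(e^{-V_{2n+1}})$, $V_{2n+2}=V_{2n+1}$. Sinkhorn transitions: $$\mathcal{K}_{2n}(x,dy)=\frac{K(x,dy)e^{-V_{2n}(y)}}{K(e^{-V_{2n}})(x)},\qquad \mathcal{K}_{2n+1}(y,dx)=\frac{K^{\flat}(y,dx)e^{-U_{2n+1}(x)}}{K^{\flat}(e^{-U_{2n+1}})(y)}.$$ Bridges and marginals: $\mathcal{P}_{2n}(d(x,y))=\mu(dx)\mathcal{K}_{2n}(x,dy)$,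 $\mathcal{P}_{2n+1}(d(x,y))=\eta(dy)\mathcal{K}_{2n+1}(y,dx)$, $\pi_{2n}=\mu\mathcal{K}_{2n}$, $\pi_{2n+1}=\eta\mathcal{K}_{2n+1}$. For a Markov transition $L$ and weights $f_1,f_2$, let $\mathrm{lip}_{f_1,f_2}(L)=\sup |m_1L-m_2L|(f_2)/|m_1-m_2|(f_1)$ over probability measures $m_1,m_2$ with $m_i(f_1)<\infty$ and $|m_1-m_2|(f_1)>0$. For $a>0$ and $\varrho\in(0,1)$ consider $$(\ast)\qquad \mathrm{lip}_{g_a,h_a}(\mathcal{K}_{2n})\vee\mathrm{lip}_{h_a,g_a}(\mathcal{K}_{2n+1})\le\varrho\quad\text{for all } n\ge1 .$$ Theorem. Under these assumptions the following hold. 1. $\mathcal{P}_0=P$, the $\mathcal{K}_n$ are Markov, and they satisfy the Sinkhorn conditioning recursions $\pi_{2n}(dy)\mathcal{K}_{2n+1}(y,dx)=\mu(dx)\mathcal{K}_{2n}(x,dy)$ and $\pi_{2n+1}(dx)\mathcal{K}_{2n+2}(x,dy)=\eta(dy)\mathcal{K}_{2n+1}(y,dx)$ for all $n\ge0$. Moreover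 $$\frac{d\eta}{d\pi_{2n}}(y)=\frac{e^{-V(y)}}{e^{-V_{2n}(y)}K^{\flat}(e^{-U_{2n}})(y)},\qquad \frac{d\mu}{d\pi_{2n+1}}(x)=\frac{e^{-U(x)}}{e^{-U_{2n+1}(x)}K(e^{-V_{2n+1}})(x)}$$ are versions of the Radon-Nikodym derivatives (used below, so that all quantities are defined at every point). 2. $\sum_{l\ge0}\big\|\log\frac{d\mu}{d\pi_{2l+1}}\big\|_g<\infty$ and $\sum_{l\ge0}\big\|\log\frac{d\eta}{d\pi_{2l}}\big\|_h<\infty$, and the functions $$\mathbb{U}=U_0-\sum_{l\ge0}\log\frac{d\mu}{d\pi_{2l+1}},\qquad \mathbb{V}=V_0-\sum_{l\ge0}\log\frac{d\eta}{d\pi_{2l}}$$ solve the Schrödinger system $\mathbb{U}=U+\log K(e^{-\mathbb{V}})$, $\mathbb{V}=V+\log K^{\flat}(e^{-\mathbb{U}})$ at every point. 3. There is a unique coupling $P_{\mu,\eta}$ of $\mu$ and $\eta$ that minimizes the relative entropy $\mathcal{H}(Q|P)$ over all couplings $Q$ of $\mu$ and $\eta$ (the Schrödinger bridge), and $P_{\mu,\eta}(d(x,y))=e^{-\mathbb{U}(x)-W(x,y)-\mathbb{V}(y)}\lambda(dx)\nu(dy)$.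 4. $(\ast)$ holds for some $a>0$ and $\varrho\in(0,1)$. For any $a>0$ and $\varrho\in(0,1)$ satisfying $(\ast)$ there is a constant $c>0$ such that for all $n\ge1$ $$\|\mathbb{U}-U_{2n}\|_g\vee\|\mathbb{V}-V_{2n}\|_h\vee\mathcal{H}(P_{\mu,\eta}\,|\,\mathcal{P}_{2n})\le c\,\varrho^{2n}.$$ -/

import Mathlib

open MeasureTheory ProbabilityTheory
open scoped ENNReal Topology

noncomputable section

namespace Sinkhorn

/-! ### Function spaces and weighted norms -/

/-- Every point has a neighbourhood on which `f` is bounded. -/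
def LocallyBounded {Z : Type*} [TopologicalSpace Z] (f : Z → ℝ) : Prop :=
  ∀ z, ∃ s ∈ 𝓝 z, ∃ C : ℝ, ∀ w ∈ s, |f w| ≤ C

/-- All sub-level sets of `f` are compact. -/
def CompactSublevels {Z : Type*} [TopologicalSpace Z] (f : Z → ℝ) : Prop :=
  ∀ r : ℝ, IsCompact {z | f z ≤ r}

/-- Locally upper bounded, uniformly positive functions with compact sub-level sets. -/
structure MemBInfty {Z : Type*} [TopologicalSpace Z] (f : Z → ℝ) : Prop where
  locally_bdd_above : ∀ z, ∃ s ∈ 𝓝 z, ∃ C : ℝ, ∀ w ∈ s, f w ≤ C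
  uniformly_pos : ∃ ε : ℝ, 0 < ε ∧ ∀ z, ε ≤ f z
  compact_sublevels : CompactSublevels f

/-- Positive functions `θ` such that `1 / θ` belongs to the previous class. -/
def MemBZero {Z : Type*} [TopologicalSpace Z] (θ : Z → ℝ) : Prop :=
  (∀ z, 0 < θ z) ∧ MemBInfty (fun z => 1 / θ z)

/-- The weighted uniform norm `‖f‖_g = sup_z |f z| / g z` (for a positive weight `g`). -/
def wnorm {Z : Type*} (g f : Z → ℝ) : ℝ≥0∞ :=
  ⨆ z, ENNReal.ofReal (|f z| / g z)

/-- The `g`-weighted total variation `|m₁ - m₂|(g)` of two finite measures. Here `m₁ - m₂` and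
`m₂ - m₁` are the truncated differences of measures, that is the positive and the negative part of
the Hahn-Jordan decomposition of the signed measure `m₁ - m₂`. -/
def wtv {Z : Type*} [MeasurableSpace Z] (g : Z → ℝ) (m₁ m₂ : Measure Z) : ℝ≥0∞ :=
  ∫⁻ z, ENNReal.ofReal (g z) ∂((m₁ - m₂) + (m₂ - m₁))

/-- Probability measures that integrate `g`. -/
def MemProb {Z : Type*} [MeasurableSpace Z] (g : Z → ℝ) (m : Measure Z) : Prop :=
  IsProbabilityMeasure m ∧ ∫⁻ z, ENNReal.ofReal (g z) ∂m < ∞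

/-- The Lipschitz (Kantorovich) norm of the left action of a kernel `K`: the supremum of
`|m₁K - m₂K|(h) / |m₁ - m₂|(g)`. -/
def lip {X Y : Type*} [MeasurableSpace X] [MeasurableSpace Y]
    (g : X → ℝ) (h : Y → ℝ) (K : Kernel X Y) : ℝ≥0∞ :=
  ⨆ (m₁ : Measure X) (m₂ : Measure X) (_ : MemProb g m₁) (_ : MemProb g m₂)
    (_ : 0 < wtv g m₁ m₂), wtv h (m₁.bind K) (m₂.bind K) / wtv g m₁ m₂

/-! ### Schrödinger bridges -/

/-- `Q` is a coupling of `μ` and `η`. -/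
def IsCoupling {X Y : Type*} [MeasurableSpace X] [MeasurableSpace Y]
    (μ : Measure X) (η : Measure Y) (Q : Measure (X × Y)) : Prop :=
  Q.fst = μ ∧ Q.snd = η

/-- `Q` minimizes the relative entropy with respect to `P` among all couplings of `μ` and `η`. -/
def IsSchrodingerBridge {X Y : Type*} [MeasurableSpace X] [MeasurableSpace Y]
    (P : Measure (X × Y)) (μ : Measure X) (η : Measure Y) (Q : Measure (X × Y)) : Prop :=
  IsCoupling μ η Q ∧
    ∀ R, IsCoupling μ η R → InformationTheory.klDiv Q P ≤ InformationTheory.klDiv R P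

/-! ### Integral operators, transitions and potentials -/

/-- The Gibbs measure `e^{-U} dm`. -/
def gibbs {Z : Type*} [MeasurableSpace Z] (m : Measure Z) (U : Z → ℝ) : Measure Z :=
  m.withDensity (fun z => ENNReal.ofReal (Real.exp (-U z)))

/-- The flipped transition potential `W♭(y,x) = W(x,y)`. -/
def flat {X Y : Type*} (W : X → Y → ℝ) : Y → X → ℝ := fun y x => W x y

/-- The integral operator `f ↦ ∫ e^{-W(x,y)} f(y) m(dy)`. -/
def op {X Y : Type*} [MeasurableSpace Y] (W : X → Y → ℝ) (m : Measure Y) (f : Y → ℝ) (x : X) : ℝ :=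
  ∫ y, Real.exp (-W x y) * f y ∂m

/-- The kernel `e^{-W(x,y)} m(dy)`. -/
def refKernel {X Y : Type*} [MeasurableSpace X] [MeasurableSpace Y]
    (W : X → Y → ℝ) (m : Measure Y) [SFinite m] : Kernel X Y :=
  Kernel.withDensity (Kernel.const X m) (fun x y => ENNReal.ofReal (Real.exp (-W x y)))

/-- The normalized kernel `e^{-W(x,y)} e^{-v(y)} m(dy) / ∫ e^{-W(x,z)} e^{-v(z)} m(dz)`. -/
def tilted {X Y : Type*} [MeasurableSpace X] [MeasurableSpace Y]
    (W : X → Y → ℝ) (m : Measure Y) [SFinite m] (v : Y → ℝ) : Kernel X Y :=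
  Kernel.withDensity (Kernel.const X m) (fun x y => ENNReal.ofReal
    (Real.exp (-W x y) * Real.exp (-v y) / op W m (fun z => Real.exp (-v z)) x))

section Model

variable {X Y : Type*} [MeasurableSpace X] [MeasurableSpace Y]

/-- The Sinkhorn potentials `(U_n, V_n)`, started from `(U_0, V_0) = (U, 0)`:
`U_{2n+1} = U_{2n}`, `V_{2n+1} = V + log K♭(e^{-U_{2n}})`,
`U_{2n+2} = U + log K(e^{-V_{2n+1}})`, `V_{2n+2} = V_{2n+1}`. -/
def pot (lam : Measure X) (nu : Measure Y) (U : X → ℝ) (V : Y → ℝ) (W : X → Y → ℝ) :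
    ℕ → (X → ℝ) × (Y → ℝ)
  | 0 => (U, fun _ => 0)
  | n + 1 =>
    let p := pot lam nu U V W n
    if Even n then
      (p.1, fun y => V y + Real.log (op (flat W) lam (fun x => Real.exp (-p.1 x)) y))
    else
      (fun x => U x + Real.log (op W nu (fun y => Real.exp (-p.2 y)) x), p.2)

variable (lam : Measure X) (nu : Measure Y) (U : X → ℝ) (V : Y → ℝ) (W : X → Y → ℝ)

/-- The potential `U_n`. -/
def potU (n : ℕ) : X → ℝ := (pot lam nu U V W n).1

/-- The potential `V_n`. -/
def potV (n : ℕ) : Y → ℝ := (pot lam nu U V W n).2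

/-- The Sinkhorn transition `𝒦_{2n}` from `X` to `Y`. -/
def transEven [SFinite nu] (n : ℕ) : Kernel X Y := tilted W nu (potV lam nu U V W (2 * n))

/-- The Sinkhorn transition `𝒦_{2n+1}` from `Y` to `X`. -/
def transOdd [SFinite lam] (n : ℕ) : Kernel Y X :=
  tilted (flat W) lam (potU lam nu U V W (2 * n + 1))

/-- The Sinkhorn bridge `𝒫_{2n} = μ × 𝒦_{2n}`, with `μ = e^{-U} dλ`. -/
def bridgeEven [SFinite nu] (n : ℕ) : Measure (X × Y) :=
  (gibbs lam U).compProd (transEven lam nu U V W n)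

/-- The Sinkhorn bridge `𝒫_{2n+1}`, the flip of `η × 𝒦_{2n+1}`, with `η = e^{-V} dν`. -/
def bridgeOdd [SFinite lam] (n : ℕ) : Measure (X × Y) :=
  ((gibbs nu V).compProd (transOdd lam nu U V W n)).map Prod.swap

/-- The distribution `π_{2n} = μ 𝒦_{2n}`. -/
def piEven [SFinite nu] (n : ℕ) : Measure Y := (gibbs lam U).bind (transEven lam nu U V W n)

/-- The distribution `π_{2n+1} = η 𝒦_{2n+1}`. -/
def piOdd [SFinite lam] (n : ℕ) : Measure X := (gibbs nu V).bind (transOdd lam nu U V W n)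

/-- The conditioning (Bayes) recursions of the Sinkhorn algorithm for the transitions above:
they are Markov, `𝒫_0` is the reference measure `μ × K`, and
`(π_{2n} × 𝒦_{2n+1})♭ = μ × 𝒦_{2n}`, `π_{2n+1} × 𝒦_{2n+2} = (η × 𝒦_{2n+1})♭`. -/
def BayesRecursion [SFinite lam] [SFinite nu] : Prop :=
  bridgeEven lam nu U V W 0 = (gibbs lam U).compProd (refKernel W nu) ∧
  ∀ n : ℕ,
    IsMarkovKernel (transEven lam nu U V W n) ∧ IsMarkovKernel (transOdd lam nu U V W n) ∧
    ((piEven lam nu U V W n).compProd (transOdd lam nu U V W n)).map Prod.swap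
      = bridgeEven lam nu U V W n ∧
    (piOdd lam nu U V W n).compProd (transEven lam nu U V W (n + 1)) = bridgeOdd lam nu U V W n

/-- The everywhere defined version of the density `dη/dπ_{2n}`, namely
`e^{-V(y)} / ∫ e^{-U_{2n}(x) - W(x,y) - V_{2n}(y)} λ(dx)`. -/
def ratioY (n : ℕ) (y : Y) : ℝ :=
  Real.exp (-V y) / (Real.exp (-potV lam nu U V W (2 * n) y) *
    op (flat W) lam (fun x => Real.exp (-potU lam nu U V W (2 * n) x)) y)

/-- The everywhere defined version of the density `dμ/dπ_{2n+1}`, namely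
`e^{-U(x)} / ∫ e^{-U_{2n+1}(x) - W(x,y) - V_{2n+1}(y)} ν(dy)`. -/
def ratioX (n : ℕ) (x : X) : ℝ :=
  Real.exp (-U x) / (Real.exp (-potU lam nu U V W (2 * n + 1) x) *
    op W nu (fun y => Real.exp (-potV lam nu U V W (2 * n + 1) y)) x)

/-- `𝕌 = U_0 - ∑_{l ≥ 0} log (dμ/dπ_{2l+1})`. -/
def limU (x : X) : ℝ :=
  potU lam nu U V W 0 x - ∑' l : ℕ, Real.log (ratioX lam nu U V W l x)

/-- `𝕍 = V_0 - ∑_{l ≥ 0} log (dη/dπ_{2l})`. -/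
def limV (y : Y) : ℝ :=
  potV lam nu U V W 0 y - ∑' l : ℕ, Real.log (ratioY lam nu U V W l y)

/-- The Lyapunov condition with parameter `δ`. As `W` is bounded below, `W^V(x) = ∫ W(x,y) η(dy)`
always exists in `(-∞, ∞]`, and the domination of `e^{-(δ U - W^V)}` by a real function forces it
to be finite; this is why integrability is a clause (similarly for `W_U`). -/
def ConditionA [TopologicalSpace X] [TopologicalSpace Y] (δ : ℝ) : Prop :=
  0 < δ ∧ δ < 1 / 2 ∧
  ∫⁻ x, ENNReal.ofReal (Real.exp (-((1 - 2 * δ) * U x))) ∂lam < ∞ ∧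
  ∫⁻ y, ENNReal.ofReal (Real.exp (-((1 - 2 * δ) * V y))) ∂nu < ∞ ∧
  (∀ x, Integrable (fun y => W x y) (gibbs nu V)) ∧
  (∀ y, Integrable (fun x => W x y) (gibbs lam U)) ∧
  (∃ θu : X → ℝ, MemBZero θu ∧
    ∀ x, Real.exp (-(δ * U x - ∫ y, W x y ∂(gibbs nu V))) ≤ θu x) ∧
  (∃ θv : Y → ℝ, MemBZero θv ∧
    ∀ y, Real.exp (-(δ * V y - ∫ x, W x y ∂(gibbs lam U))) ≤ θv y)

/-- The uniform contraction `lip_{g_a,h_a}(𝒦_{2n}) ∨ lip_{h_a,g_a}(𝒦_{2n+1}) ≤ ϱ` for all `n ≥ 1`,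
with `g_a = 1/2 + a e^{δU}` and `h_a = 1/2 + a e^{δV}`. -/
def UniformContraction [SFinite lam] [SFinite nu] (δ a ϱ : ℝ) : Prop :=
  ∀ n : ℕ, 1 ≤ n →
    lip (fun x => 1 / 2 + a * Real.exp (δ * U x)) (fun y => 1 / 2 + a * Real.exp (δ * V y))
      (transEven lam nu U V W n) ≤ ENNReal.ofReal ϱ ∧
    lip (fun y => 1 / 2 + a * Real.exp (δ * V y)) (fun x => 1 / 2 + a * Real.exp (δ * U x))
      (transOdd lam nu U V W n) ≤ ENNReal.ofReal ϱ

end Model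

end Sinkhorn

end

/-! Relative to the probability measures μ and η the potentials become φ = u - U and ψ = v - V, and
a Sinkhorn half-step is the log-partition map `lse`. Let k ≥ 0 bound -W. Jensen's inequality bounds
a new potential below by minus the mean cost minus the integral of the preceding potential. These
integrals stay below k (`Sys.integral_lse_le`): e^{φ_{n+1}-φ_n} is the density dπ_{2n+1}/dμ, so t ≤
e^t - 1 makes ∫ φ_n dμ nonincreasing. The lower bounds dominate e^{-ψ} by a multiple of e^{W_U},
which is η-integrable by condition (A); this gives a uniform upper bound. All iterates thus lie in
one class (`Sys.exists_adm`).

On that class the Gibbs transitions share a drift inequality (lower bounds, and e^{W^V} negligible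
against g) and a minorization on sub-level sets (upper bounds, and W bounded on compacts). By the
Hairer-Mattingly argument they contract the total variation weighted by 1/2 + a g and 1/2 + a h at a
common rate, for small a (`Sys.exists_contraction`). Now 𝒦_{2n+2} maps π_{2n+1} to η and μ to
π_{2n+2}, and 𝒦_{2n+3} maps π_{2n+2} to μ and η to π_{2n+3}. Hence the distances of the marginals to
their targets decay like ϱ^{2n}. The log-partition map turns these weighted L¹ distances into
weighted sup norms (`Sys.exists_abs_lse_sub_le`), so the increments of the potentials, which are the
log-ratios up to sign, are summable (`Model.exists_decay`). Dominated convergence gives the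
Schrödinger system for the limits.

The limiting coupling has a density e^{α(x)+β(y)} with respect to each 𝒫_{2n}. Since ∫ (α+β) is the
same for all couplings, the chain rule for relative entropy makes it the unique minimizer
(`isSchrodingerBridge_of_density`), and its entropy relative to 𝒫_{2n} is the integral of the errors
of the potentials, hence also of order ϱ^{2n}. -/

noncomputable section

namespace Sinkhorn

/-! ### Weighted total variation -/

section WeightedTV

variable {Z : Type*} [MeasurableSpace Z]

/-- Truncated differences of finite measures have the truncated differences of the densities as
densities, and at each point at least one of the two vanishes. -/
lemma wtv_withDensity {g : Z → ℝ} (hg : Measurable g) {M : Measure Z} {r₁ r₂ : Z → ℝ}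
    (h₁ : Measurable r₁) (h₂ : Measurable r₂) (p₁ : ∀ z, 0 ≤ r₁ z) (p₂ : ∀ z, 0 ≤ r₂ z)
    [IsFiniteMeasure (M.withDensity fun z => ENNReal.ofReal (r₁ z))]
    [IsFiniteMeasure (M.withDensity fun z => ENNReal.ofReal (r₂ z))] :
    wtv g (M.withDensity fun z => ENNReal.ofReal (r₁ z))
      (M.withDensity fun z => ENNReal.ofReal (r₂ z))
      = ∫⁻ z, ENNReal.ofReal (g z * |r₁ z - r₂ z|) ∂M := by
  unfold wtv
  rw [← Measure.withDensity_sub h₁.ennreal_ofReal h₂.ennreal_ofReal,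
    ← Measure.withDensity_sub h₂.ennreal_ofReal h₁.ennreal_ofReal,
    ← withDensity_add_left (h₁.ennreal_ofReal.sub h₂.ennreal_ofReal),
    lintegral_withDensity_eq_lintegral_mul _ (((h₁.ennreal_ofReal.sub h₂.ennreal_ofReal)).add
      (h₂.ennreal_ofReal.sub h₁.ennreal_ofReal)) hg.ennreal_ofReal]
  refine lintegral_congr fun z => ?_
  simp only [Pi.mul_apply, Pi.add_apply, Pi.sub_apply]
  rw [← ENNReal.ofReal_sub _ (p₂ z), ← ENNReal.ofReal_sub _ (p₁ z), mul_comm,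
    ENNReal.ofReal_mul' (abs_nonneg _)]
  congr 1
  rcases le_total (r₁ z) (r₂ z) with h | h
  · rw [abs_of_nonpos (sub_nonpos.2 h), ENNReal.ofReal_of_nonpos (sub_nonpos.2 h), zero_add,
      neg_sub]
  · rw [abs_of_nonneg (sub_nonneg.2 h), ENNReal.ofReal_of_nonpos (sub_nonpos.2 h), add_zero]

lemma withDensity_ofReal_rnDeriv {m M : Measure Z} [IsFiniteMeasure m] [IsFiniteMeasure M]
    (h : m ≪ M) : M.withDensity (fun z => ENNReal.ofReal (m.rnDeriv M z).toReal) = m := by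
  have e : M.withDensity (fun z => ENNReal.ofReal (m.rnDeriv M z).toReal)
      = M.withDensity (m.rnDeriv M) := by
    refine withDensity_congr_ae ?_
    filter_upwards [Measure.rnDeriv_lt_top m M] with z hz
    exact ENNReal.ofReal_toReal hz.ne
  rw [e, Measure.withDensity_rnDeriv_eq m M h]

lemma wtv_eq_lintegral_rnDeriv {g : Z → ℝ} (hg : Measurable g) {m₁ m₂ M : Measure Z}
    [IsFiniteMeasure m₁] [IsFiniteMeasure m₂] [IsFiniteMeasure M] (a₁ : m₁ ≪ M) (a₂ : m₂ ≪ M) :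
    wtv g m₁ m₂ = ∫⁻ z, ENNReal.ofReal (g z *
      |(m₁.rnDeriv M z).toReal - (m₂.rnDeriv M z).toReal|) ∂M := by
  have k₁ := withDensity_ofReal_rnDeriv a₁
  have k₂ := withDensity_ofReal_rnDeriv a₂
  have i₁ : IsFiniteMeasure (M.withDensity
      (fun z => ENNReal.ofReal (m₁.rnDeriv M z).toReal)) := by rw [k₁]; infer_instance
  have i₂ : IsFiniteMeasure (M.withDensity
      (fun z => ENNReal.ofReal (m₂.rnDeriv M z).toReal)) := by rw [k₂]; infer_instance
  rw [← wtv_withDensity hg (Measure.measurable_rnDeriv _ _).ennreal_toReal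
    (Measure.measurable_rnDeriv _ _).ennreal_toReal (fun _ => ENNReal.toReal_nonneg)
    (fun _ => ENNReal.toReal_nonneg), k₁, k₂]

lemma integral_sub_integral_eq_rnDeriv {m₁ m₂ M : Measure Z} [IsFiniteMeasure m₁]
    [IsFiniteMeasure m₂] [IsFiniteMeasure M] (a₁ : m₁ ≪ M) (a₂ : m₂ ≪ M)
    {f : Z → ℝ} (h₁ : Integrable f m₁) (h₂ : Integrable f m₂) :
    Integrable (fun z => f z * ((m₁.rnDeriv M z).toReal - (m₂.rnDeriv M z).toReal)) M ∧
    ∫ z, f z ∂m₁ - ∫ z, f z ∂m₂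
      = ∫ z, f z * ((m₁.rnDeriv M z).toReal - (m₂.rnDeriv M z).toReal) ∂M := by
  have i₁ := (integrable_rnDeriv_smul_iff a₁).2 h₁
  have i₂ := (integrable_rnDeriv_smul_iff a₂).2 h₂
  have e : (fun z => f z * ((m₁.rnDeriv M z).toReal - (m₂.rnDeriv M z).toReal)) = fun z =>
      (m₁.rnDeriv M z).toReal • f z - (m₂.rnDeriv M z).toReal • f z := by
    funext z; simp only [smul_eq_mul]; ring
  rw [e]
  refine ⟨i₁.sub i₂, ?_⟩
  rw [integral_sub i₁ i₂, integral_rnDeriv_smul a₁, integral_rnDeriv_smul a₂]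

lemma exists_dominating (m₁ m₂ : Measure Z) [IsFiniteMeasure m₁] [IsFiniteMeasure m₂] :
    ∃ M : Measure Z, IsFiniteMeasure M ∧ m₁ ≪ M ∧ m₂ ≪ M :=
  ⟨m₁ + m₂, inferInstance, Measure.AbsolutelyContinuous.rfl.add_right _, by
    rw [add_comm]; exact Measure.AbsolutelyContinuous.rfl.add_right _⟩

/-- The weighted total variation is attained at a test function of the form `g * s`, `|s| ≤ 1`. -/
lemma exists_wtv_eq {g : Z → ℝ} (hg : Measurable g) (g0 : ∀ z, 0 ≤ g z) (m₁ m₂ : Measure Z)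
    [IsFiniteMeasure m₁] [IsFiniteMeasure m₂] (h₁ : Integrable g m₁) (h₂ : Integrable g m₂) :
    ∃ f : Z → ℝ, Measurable f ∧ (∀ z, |f z| ≤ g z) ∧
      wtv g m₁ m₂ = ENNReal.ofReal (∫ z, f z ∂m₁ - ∫ z, f z ∂m₂) := by
  obtain ⟨M, _, a₁, a₂⟩ := exists_dominating m₁ m₂
  set r : Z → ℝ := fun z => (m₁.rnDeriv M z).toReal - (m₂.rnDeriv M z).toReal with hr
  have mr : Measurable r := (Measure.measurable_rnDeriv _ _).ennreal_toReal.sub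
    (Measure.measurable_rnDeriv _ _).ennreal_toReal
  set f : Z → ℝ := fun z => if 0 ≤ r z then g z else - g z with hf
  have mf : Measurable f := Measurable.ite (measurableSet_le measurable_const mr) hg hg.neg
  have bf : ∀ z, |f z| ≤ g z := by
    intro z
    simp only [hf]; split_ifs <;> simp [abs_of_nonneg (g0 z)]
  have fi : ∀ m : Measure Z, Integrable g m → Integrable f m := fun m hm =>
    hm.mono' mf.aestronglyMeasurable (ae_of_all _ bf)
  refine ⟨f, mf, bf, ?_⟩
  obtain ⟨i, e⟩ := integral_sub_integral_eq_rnDeriv a₁ a₂ (fi _ h₁) (fi _ h₂)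
  have e' : ∀ z, f z * r z = g z * |r z| := by
    intro z
    simp only [hf]
    split_ifs with h
    · rw [abs_of_nonneg h]
    · rw [abs_of_neg (not_le.1 h)]; ring
  rw [wtv_eq_lintegral_rnDeriv hg a₁ a₂, e, ofReal_integral_eq_lintegral_ofReal i]
  · exact lintegral_congr fun z => by rw [← e' z]
  · exact ae_of_all _ fun z => by
      rw [Pi.zero_apply]
      exact (mul_nonneg (g0 z) (abs_nonneg (r z))).trans_eq (e' z).symm

/-- Both measures have mass one, so the constant `c` cancels. Only the oscillation of `F` matters,
not its size; this is where contraction can arise. -/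
lemma integral_sub_le_wtv {g : Z → ℝ} (hg : Measurable g) (m₁ m₂ : Measure Z)
    [IsProbabilityMeasure m₁] [IsProbabilityMeasure m₂] (h₁ : Integrable g m₁)
    (h₂ : Integrable g m₂) {F : Z → ℝ} (hF : Measurable F) {c ρ : ℝ} (ρ0 : 0 ≤ ρ)
    (hFc : ∀ z, |F z - c| ≤ ρ * g z) :
    ENNReal.ofReal (∫ z, F z ∂m₁ - ∫ z, F z ∂m₂) ≤ ENNReal.ofReal ρ * wtv g m₁ m₂ := by
  obtain ⟨M, _, a₁, a₂⟩ := exists_dominating m₁ m₂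
  have hi : ∀ m : Measure Z, IsProbabilityMeasure m → Integrable g m →
      Integrable (fun z => F z - c) m := fun m _ hm =>
    (hm.const_mul ρ).mono' (hF.sub_const c).aestronglyMeasurable (ae_of_all _ hFc)
  have hs : ∀ m : Measure Z, IsProbabilityMeasure m → Integrable g m →
      ∫ z, (F z - c) ∂m = ∫ z, F z ∂m - c := fun m _ hm => by
    have : Integrable F m := by
      refine ((hi m inferInstance hm).add (integrable_const c)).congr (ae_of_all _ fun z => ?_)
      simp
    rw [integral_sub this (integrable_const c)]; simp
  have hd : ∫ z, F z ∂m₁ - ∫ z, F z ∂m₂ = ∫ z, (F z - c) ∂m₁ - ∫ z, (F z - c) ∂m₂ := by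
    rw [hs m₁ inferInstance h₁, hs m₂ inferInstance h₂]; ring
  obtain ⟨i, e⟩ := integral_sub_integral_eq_rnDeriv a₁ a₂ (hi m₁ inferInstance h₁)
    (hi m₂ inferInstance h₂)
  rw [hd, e, wtv_eq_lintegral_rnDeriv hg a₁ a₂, ← lintegral_const_mul' _ _ ENNReal.ofReal_ne_top]
  refine (ENNReal.ofReal_le_ofReal (le_abs_self _)).trans ?_
  rw [← Real.enorm_eq_ofReal_abs]
  refine (enorm_integral_le_lintegral_enorm _).trans (lintegral_mono fun z => ?_)
  rw [Real.enorm_eq_ofReal_abs, ← ENNReal.ofReal_mul ρ0, abs_mul, ← mul_assoc]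
  exact ENNReal.ofReal_le_ofReal (mul_le_mul_of_nonneg_right (hFc z) (abs_nonneg _))

end WeightedTV

/-! ### The Lipschitz norm of a Markov kernel -/

section Lip

variable {X Y : Type*} [MeasurableSpace X] [MeasurableSpace Y]

/-- The intervals [F x - g x, F x + g x] meet pairwise, hence have a common point, as in Helly's
theorem on the line. The supremum of the left endpoints is one. -/
lemma exists_abs_sub_le_of_sub_le {Z : Type*} {F g : Z → ℝ} [Nonempty Z]
    (H : ∀ x x', F x - F x' ≤ g x + g x') : ∃ c, ∀ x, |F x - c| ≤ g x := by
  obtain ⟨x₀⟩ := ‹Nonempty Z›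
  have hb : BddAbove (Set.range fun x => F x - g x) :=
    ⟨F x₀ + g x₀, by rintro _ ⟨x, rfl⟩; linarith [H x x₀]⟩
  refine ⟨⨆ x, (F x - g x), fun x => abs_le.2 ⟨?_, ?_⟩⟩
  · have : ⨆ z, (F z - g z) ≤ F x + g x := by
      have : Nonempty Z := ⟨x₀⟩
      exact ciSup_le fun z => by linarith [H z x]
    linarith
  · linarith [le_ciSup hb x]

lemma integrable_of_memProb {g : X → ℝ} (hg : Measurable g) (g0 : ∀ x, 0 ≤ g x) {m : Measure X}
    (hm : MemProb g m) : Integrable g m := by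
  refine ⟨hg.aestronglyMeasurable, ?_⟩
  rw [hasFiniteIntegral_iff_ofReal (ae_of_all _ g0)]
  exact hm.2

lemma integrable_bind {K : Kernel X Y} [IsMarkovKernel K] {g : X → ℝ} {h : Y → ℝ}
    (hh : Measurable h) (h0 : ∀ y, 0 ≤ h y) (hi : ∀ x, Integrable h (K x)) {C : ℝ}
    (hC : ∀ x, ∫ y, h y ∂(K x) ≤ C * g x) {m : Measure X} (hm : Integrable g m) :
    Integrable h (m.bind K) := by
  refine ⟨hh.aestronglyMeasurable, ?_⟩
  rw [hasFiniteIntegral_iff_ofReal (ae_of_all _ h0),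
    Measure.lintegral_bind K.aemeasurable hh.ennreal_ofReal.aemeasurable]
  have : ∀ x, ∫⁻ y, ENNReal.ofReal (h y) ∂(K x) ≤ ENNReal.ofReal (C * g x) := fun x => by
    rw [← ofReal_integral_eq_lintegral_ofReal (hi x) (ae_of_all _ h0)]
    exact ENNReal.ofReal_le_ofReal (hC x)
  refine (lintegral_mono this).trans_lt ?_
  exact ((hm.const_mul C).lintegral_lt_top)

lemma integral_bind {K : Kernel X Y} {m : Measure X} {f : Y → ℝ} (hf : Integrable f (m.bind K)) :
    ∫ y, f y ∂(m.bind K) = ∫ x, ∫ y, f y ∂(K x) ∂m := by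
  rw [Measure.comp_eq_comp_const_apply] at hf ⊢
  rw [Kernel.integral_comp hf, Kernel.const_apply]

/-- A Dobrushin type criterion: an oscillation bound for test functions controls the Lipschitz
norm. -/
lemma lip_le {g : X → ℝ} {h : Y → ℝ} (hg : Measurable g) (hh : Measurable h)
    (g0 : ∀ x, 0 ≤ g x) (h0 : ∀ y, 0 ≤ h y) {K : Kernel X Y} [IsMarkovKernel K]
    (hi : ∀ x, Integrable h (K x)) {C : ℝ} (hC : ∀ x, ∫ y, h y ∂(K x) ≤ C * g x)
    {ρ : ℝ} (ρ0 : 0 ≤ ρ)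
    (H : ∀ f : Y → ℝ, Measurable f → (∀ y, |f y| ≤ h y) →
      ∀ x x', ∫ y, f y ∂(K x) - ∫ y, f y ∂(K x') ≤ ρ * (g x + g x')) :
    lip g h K ≤ ENNReal.ofReal ρ := by
  unfold lip
  refine iSup_le fun m₁ => iSup_le fun m₂ => iSup_le fun hm₁ => iSup_le fun hm₂ =>
    iSup_le fun _ => ENNReal.div_le_of_le_mul ?_
  have := hm₁.1
  have := hm₂.1
  have : Nonempty X := nonempty_of_isProbabilityMeasure m₁
  have gi₁ := integrable_of_memProb hg g0 hm₁
  have gi₂ := integrable_of_memProb hg g0 hm₂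
  have hi₁ := integrable_bind hh h0 hi hC gi₁
  have hi₂ := integrable_bind hh h0 hi hC gi₂
  obtain ⟨f, mf, bf, e⟩ := exists_wtv_eq hh h0 (m₁.bind K) (m₂.bind K) hi₁ hi₂
  have fi : ∀ m : Measure Y, Integrable h m → Integrable f m := fun m hm =>
    hm.mono' mf.aestronglyMeasurable (ae_of_all _ bf)
  obtain ⟨c, hc⟩ := exists_abs_sub_le_of_sub_le (F := fun x => ∫ y, f y ∂(K x))
    (g := fun x => ρ * g x) (fun x x' => by linarith [H f mf bf x x'])
  rw [e, integral_bind (fi _ hi₁), integral_bind (fi _ hi₂)]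
  exact integral_sub_le_wtv hg m₁ m₂ gi₁ gi₂
    (mf.stronglyMeasurable.integral_kernel (κ := K)).measurable ρ0 hc

/-- The supremum `lip` ignores pairs at distance zero; for these the positivity of the weight forces
`m₁ = m₂`. -/
lemma wtv_bind_le_of_lip_le {g : X → ℝ} {h : Y → ℝ} (hg : Measurable g)
    (g0 : ∀ x, 0 < g x) {K : Kernel X Y} {ρ : ℝ≥0∞} (hK : lip g h K ≤ ρ)
    {m₁ m₂ : Measure X} (hm₁ : MemProb g m₁) (hm₂ : MemProb g m₂) (hfin : wtv g m₁ m₂ ≠ ∞) :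
    wtv h (m₁.bind K) (m₂.bind K) ≤ ρ * wtv g m₁ m₂ := by
  have := hm₁.1
  have := hm₂.1
  by_cases h0 : wtv g m₁ m₂ = 0
  · have hz : (m₁ - m₂) + (m₂ - m₁) = 0 := by
      unfold wtv at h0
      rw [lintegral_eq_zero_iff hg.ennreal_ofReal] at h0
      rw [← Measure.measure_univ_eq_zero]
      have : ∀ᵐ _ ∂((m₁ - m₂) + (m₂ - m₁)), False := by
        filter_upwards [h0] with z hz
        exact absurd hz (by simpa using g0 z)
      simpa [ae_iff] using this
    have hz₁ : m₁ - m₂ ≤ 0 := hz ▸ Measure.le_add_right le_rfl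
    have hz₂ : m₂ - m₁ ≤ 0 := hz ▸ Measure.le_add_left le_rfl
    have : m₁ = m₂ := le_antisymm (by simpa using Measure.sub_le_iff_le_add.1 hz₁)
      (by simpa using Measure.sub_le_iff_le_add.1 hz₂)
    subst this
    simp [wtv]
  · have h1 : wtv h (m₁.bind K) (m₂.bind K) / wtv g m₁ m₂ ≤ lip g h K :=
      le_iSup_of_le m₁ (le_iSup_of_le m₂ (le_iSup_of_le hm₁ (le_iSup_of_le hm₂
        (le_iSup_of_le (pos_iff_ne_zero.2 h0) le_rfl))))
    rw [← ENNReal.div_le_iff h0 hfin]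
    exact h1.trans hK

end Lip

/-! ### Normalized Schrödinger systems -/

section System

variable {X Y : Type*} [MeasurableSpace X] [MeasurableSpace Y]

/-- The log-partition function `log ∫ e^{-W(x,y) - ψ(y)} η(dy)`. -/
def lse (W : X → Y → ℝ) (η : Measure Y) (ψ : Y → ℝ) (x : X) : ℝ :=
  Real.log (∫ y, Real.exp (-W x y - ψ y) ∂η)

/-- Integrability, drift and minorization conditions on one of the two marginal spaces. -/
structure HalfSys (μ : Measure X) (η : Measure Y) (W : X → Y → ℝ) (g : X → ℝ) : Prop where
  meas_weight : Measurable g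
  weight_pos : ∃ ε : ℝ, 0 < ε ∧ ∀ x, ε ≤ g x
  integrable_sq : Integrable (fun x => g x ^ 2) μ
  integrable_cost : ∀ x, Integrable (W x) η
  drift : ∀ ε : ℝ, 0 < ε → ∃ c : ℝ, ∀ x, Real.exp (∫ y, W x y ∂η) ≤ ε * g x + c
  minor : ∀ r : ℝ, ∃ D : Set Y, MeasurableSet D ∧ 0 < η D ∧
    ∃ M : ℝ, ∀ x, g x ≤ r → ∀ y ∈ D, W x y ≤ M

/-- Two probability measures and a cost satisfying the conditions on both marginal spaces. -/
structure Sys (μ : Measure X) (η : Measure Y) (W : X → Y → ℝ) (g : X → ℝ) (h : Y → ℝ)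
    (k : ℝ) : Prop where
  prob_left : IsProbabilityMeasure μ
  prob_right : IsProbabilityMeasure η
  meas_cost : Measurable (Function.uncurry W)
  bound_nonneg : 0 ≤ k
  neg_cost_le : ∀ x y, -W x y ≤ k
  left : HalfSys μ η W g
  right : HalfSys η μ (flat W) h

/-- Measurable potentials bounded below by `-∫ W(·,y) η(dy) - k`. -/
structure LowerPot (η : Measure Y) (W : X → Y → ℝ) (k : ℝ) (φ : X → ℝ) : Prop where
  meas : Measurable φ
  lower : ∀ x, -(∫ y, W x y ∂η) - k ≤ φ x

/-- The class of potentials visited by the Sinkhorn iteration. -/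
structure Adm (μ : Measure X) (η : Measure Y) (W : X → Y → ℝ) (k K : ℝ) (φ : X → ℝ) : Prop
    extends LowerPot η W k φ where
  upper : ∀ x, φ x ≤ K
  integral_le : ∫ x, φ x ∂μ ≤ k

variable {μ : Measure X} {η : Measure Y} {W : X → Y → ℝ} {g : X → ℝ} {h : Y → ℝ} {k K : ℝ}
  {φ φ' : X → ℝ} {ψ ψ' : Y → ℝ}

namespace Sys

/-- Estimates are proved for one marginal and read off for the other through this exchange. -/
lemma symm (S : Sys μ η W g h k) : Sys η μ (flat W) h g k where
  prob_left := S.prob_right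
  prob_right := S.prob_left
  meas_cost := S.meas_cost.comp measurable_swap
  bound_nonneg := S.bound_nonneg
  neg_cost_le := fun y x => S.neg_cost_le x y
  left := S.right
  right := S.left

lemma meas_section (S : Sys μ η W g h k) (x : X) : Measurable (W x) :=
  S.meas_cost.comp measurable_prodMk_left

lemma measurable_mean (S : Sys μ η W g h k) : Measurable fun x => ∫ y, W x y ∂η := by
  have := S.prob_right
  exact (S.meas_cost.stronglyMeasurable.integral_prod_right (ν := η)).measurable

lemma neg_mean_le (S : Sys μ η W g h k) (x : X) : -(∫ y, W x y ∂η) ≤ k := by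
  have := S.prob_right
  rw [← integral_neg]
  calc ∫ y, -W x y ∂η ≤ ∫ _, k ∂η :=
        integral_mono (S.left.integrable_cost x).neg (integrable_const k) (S.neg_cost_le x)
    _ = k := by simp

lemma exists_affine_le (S : Sys μ η W g h k) (c : ℝ) : ∃ C : ℝ, 0 < C ∧ ∀ x, g x + c ≤ C * g x := by
  obtain ⟨ε, ε0, hε⟩ := S.left.weight_pos
  refine ⟨1 + |c| / ε, by positivity, fun x => ?_⟩
  have : c ≤ |c| / ε * g x := by
    calc c ≤ |c| := le_abs_self c
      _ = |c| / ε * ε := by field_simp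
      _ ≤ |c| / ε * g x := by gcongr; exact hε x
  linarith

lemma weight_pos' (S : Sys μ η W g h k) (x : X) : 0 < g x := by
  obtain ⟨ε, ε0, hε⟩ := S.left.weight_pos
  exact ε0.trans_le (hε x)

lemma exists_exp_mean_le (S : Sys μ η W g h k) :
    ∃ C : ℝ, 0 < C ∧ ∀ x, Real.exp (∫ y, W x y ∂η) ≤ C * g x := by
  obtain ⟨c, hc⟩ := S.left.drift 1 one_pos
  obtain ⟨C, C0, hC⟩ := S.exists_affine_le c
  exact ⟨C, C0, fun x => (hc x).trans (by simpa using hC x)⟩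

lemma integrable_weight (S : Sys μ η W g h k) : Integrable g μ := by
  have := S.prob_left
  refine (S.left.integrable_sq.add (integrable_const 1)).mono'
    S.left.meas_weight.aestronglyMeasurable (ae_of_all _ fun x => ?_)
  rw [Real.norm_eq_abs, abs_of_pos (S.weight_pos' x)]
  simp only [Pi.add_apply]
  nlinarith [sq_nonneg (g x - 1), S.weight_pos' x]

/-- The exponential of the mean cost is itself dominated by the weight; this is why the square of
the weight has to be integrable. -/
lemma integrable_weight_mul_exp_mean (S : Sys μ η W g h k) :
    Integrable (fun x => g x * Real.exp (∫ y, W x y ∂η)) μ := by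
  obtain ⟨C, C0, hC⟩ := S.exists_exp_mean_le
  refine (S.left.integrable_sq.const_mul C).mono'
    (S.left.meas_weight.mul S.measurable_mean.exp).aestronglyMeasurable (ae_of_all _ fun x => ?_)
  have hg := S.weight_pos' x
  rw [Real.norm_eq_abs, abs_of_pos (by positivity)]
  nlinarith [mul_le_mul_of_nonneg_left (hC x) hg.le]

lemma integrable_exp_mean (S : Sys μ η W g h k) :
    Integrable (fun x => Real.exp (∫ y, W x y ∂η)) μ := by
  obtain ⟨C, C0, hC⟩ := S.exists_exp_mean_le
  refine (S.integrable_weight.const_mul C).mono'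
    S.measurable_mean.exp.aestronglyMeasurable (ae_of_all _ fun x => ?_)
  rw [Real.norm_eq_abs, abs_of_pos (by positivity)]
  exact hC x

lemma integrable_mean (S : Sys μ η W g h k) : Integrable (fun x => ∫ y, W x y ∂η) μ := by
  have := S.prob_left
  refine (S.integrable_exp_mean.add (integrable_const k)).mono'
    S.measurable_mean.aestronglyMeasurable (ae_of_all _ fun x => ?_)
  have h1 := S.neg_mean_le x
  have h2 := Real.add_one_le_exp (∫ y, W x y ∂η)
  have h3 := Real.exp_pos (∫ y, W x y ∂η)
  have h4 := S.bound_nonneg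
  simp only [Pi.add_apply]
  exact abs_le.2 ⟨by linarith, by linarith⟩

lemma exp_neg_le (_S : Sys μ η W g h k) (hφ : LowerPot η W k φ) (x : X) :
    Real.exp (-φ x) ≤ Real.exp k * Real.exp (∫ y, W x y ∂η) := by
  rw [← Real.exp_add]
  exact Real.exp_le_exp.2 (by linarith [hφ.lower x])

lemma integrable_weight_mul_exp_neg (S : Sys μ η W g h k) (hφ : LowerPot η W k φ) :
    Integrable (fun x => g x * Real.exp (-φ x)) μ := by
  refine (S.integrable_weight_mul_exp_mean.const_mul (Real.exp k)).mono'
    (S.left.meas_weight.mul hφ.meas.neg.exp).aestronglyMeasurable (ae_of_all _ fun x => ?_)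
  have hg := S.weight_pos' x
  rw [Real.norm_eq_abs, abs_of_pos (by positivity)]
  nlinarith [mul_le_mul_of_nonneg_left (S.exp_neg_le hφ x) hg.le]

lemma integrable_exp_neg (S : Sys μ η W g h k) (hφ : LowerPot η W k φ) :
    Integrable (fun x => Real.exp (-φ x)) μ := by
  refine (S.integrable_exp_mean.const_mul (Real.exp k)).mono'
    hφ.meas.neg.exp.aestronglyMeasurable (ae_of_all _ fun x => ?_)
  rw [Real.norm_eq_abs, abs_of_pos (by positivity)]
  exact S.exp_neg_le hφ x

lemma measurable_joint (S : Sys μ η W g h k) (hψ : Measurable ψ) :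
    Measurable (fun p : X × Y => Real.exp (-W p.1 p.2 - ψ p.2)) :=
  (S.meas_cost.neg.sub (hψ.comp measurable_snd)).exp

lemma exp_cost_le (S : Sys μ η W g h k) (x : X) (y : Y) (t : ℝ) :
    Real.exp (-W x y - t) ≤ Real.exp k * Real.exp (-t) := by
  rw [← Real.exp_add]
  exact Real.exp_le_exp.2 (by linarith [S.neg_cost_le x y])

lemma integrable_ker (S : Sys μ η W g h k) (hψ : LowerPot μ (flat W) k ψ) (x : X) :
    Integrable (fun y => Real.exp (-W x y - ψ y)) η := by
  refine ((S.symm.integrable_exp_neg hψ).const_mul (Real.exp k)).mono'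
    ((S.meas_section x).neg.sub hψ.meas).exp.aestronglyMeasurable (ae_of_all _ fun y => ?_)
  rw [Real.norm_eq_abs, abs_of_pos (by positivity)]
  exact S.exp_cost_le x y _

lemma integral_ker_pos (S : Sys μ η W g h k) (hψ : LowerPot μ (flat W) k ψ) (x : X) :
    0 < ∫ y, Real.exp (-W x y - ψ y) ∂η := by
  have := S.prob_right
  exact integral_exp_pos (S.integrable_ker hψ x)

lemma exp_lse (S : Sys μ η W g h k) (hψ : LowerPot μ (flat W) k ψ) (x : X) :
    Real.exp (lse W η ψ x) = ∫ y, Real.exp (-W x y - ψ y) ∂η :=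
  Real.exp_log (S.integral_ker_pos hψ x)

lemma measurable_lse (S : Sys μ η W g h k) (hψ : Measurable ψ) : Measurable (lse W η ψ) := by
  have := S.prob_right
  exact ((S.measurable_joint hψ).stronglyMeasurable.integral_prod_right (ν := η)).measurable.log

/-- The bound depends neither on `ψ` nor on `x`: both e^{-W} and e^{-ψ} are dominated, the latter by
an integrable function. -/
lemma lse_le (S : Sys μ η W g h k) (hψ : LowerPot μ (flat W) k ψ) (x : X) :
    lse W η ψ x ≤ Real.log (Real.exp k * (Real.exp k * ∫ y, Real.exp (∫ x, W x y ∂μ) ∂η)) := by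
  refine Real.log_le_log (S.integral_ker_pos hψ x) ?_
  rw [← integral_const_mul, ← integral_const_mul]
  refine integral_mono (S.integrable_ker hψ x)
    ((S.symm.integrable_exp_mean.const_mul _).const_mul _) fun y => ?_
  exact (S.exp_cost_le x y _).trans
    (mul_le_mul_of_nonneg_left (S.symm.exp_neg_le hψ y) (Real.exp_pos _).le)

lemma integrable_of_le (S : Sys μ η W g h k) (hφ : LowerPot η W k φ) (hK : ∀ x, φ x ≤ K) :
    Integrable φ μ := by
  have := S.prob_left
  refine (S.integrable_mean.norm.add (integrable_const (k + |K|))).mono'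
    hφ.meas.aestronglyMeasurable (ae_of_all _ fun x => ?_)
  have h1 := hφ.lower x
  have h2 := hK x
  have h3 := le_abs_self (∫ y, W x y ∂η)
  have h5 := le_abs_self K
  have h6 := abs_nonneg K
  have h7 := S.bound_nonneg
  have h8 := abs_nonneg (∫ y, W x y ∂η)
  simp only [Pi.add_apply, Real.norm_eq_abs]
  exact abs_le.2 ⟨by linarith, by linarith⟩

lemma integrable_adm (S : Sys μ η W g h k) (hφ : Adm μ η W k K φ) : Integrable φ μ :=
  S.integrable_of_le hφ.toLowerPot hφ.upper

/-- Jensen's inequality for the log-partition function. -/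
lemma lowerPot_lse (S : Sys μ η W g h k) (hψ : Adm η μ (flat W) k K ψ) :
    LowerPot η W k (lse W η ψ) := by
  have := S.prob_right
  refine ⟨S.measurable_lse hψ.meas, fun x => ?_⟩
  have i := S.symm.integrable_adm hψ
  have j := (S.left.integrable_cost x).neg.sub i
  have e : ∫ y, (-W x y - ψ y) ∂η = -(∫ y, W x y ∂η) - ∫ y, ψ y ∂η := by
    rw [← integral_neg]; exact integral_sub (S.left.integrable_cost x).neg i
  have J : Real.exp (∫ y, (-W x y - ψ y) ∂η) ≤ ∫ y, Real.exp (-W x y - ψ y) ∂η :=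
    convexOn_exp.map_integral_le Real.continuous_exp.continuousOn isClosed_univ
      (ae_of_all _ fun _ => Set.mem_univ _) j (S.integrable_ker hψ.toLowerPot x)
  have := (Real.le_log_iff_exp_le (S.integral_ker_pos hψ.toLowerPot x)).2 J
  unfold lse
  linarith [hψ.integral_le]

/-- Integrate e^{-W-φ-ψ} over the product. The integral in `y` gives the stated integrand; the
integral in `x` is one because `ψ` is the normalization of `φ`. Along the iteration the integrand is
the density of π_{2n+1} with respect to μ. -/
lemma integral_exp_lse_sub (S : Sys μ η W g h k) (hφ : LowerPot η W k φ)
    (hψ : LowerPot μ (flat W) k (lse (flat W) μ φ)) :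
    Integrable (fun x => Real.exp (lse W η (lse (flat W) μ φ) x - φ x)) μ ∧
    ∫ x, Real.exp (lse W η (lse (flat W) μ φ) x - φ x) ∂μ = 1 := by
  have := S.prob_left
  have := S.prob_right
  set ψ := lse (flat W) μ φ with hψd
  have mF : Measurable fun p : X × Y => Real.exp (-W p.1 p.2 - φ p.1 - ψ p.2) :=
    ((S.meas_cost.neg.sub (hφ.meas.comp measurable_fst)).sub (hψ.meas.comp measurable_snd)).exp
  have iF : Integrable (fun p : X × Y => Real.exp (-W p.1 p.2 - φ p.1 - ψ p.2)) (μ.prod η) := by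
    refine (((S.integrable_exp_neg hφ).mul_prod (S.symm.integrable_exp_neg hψ)).const_mul
      (Real.exp k)).mono' mF.aestronglyMeasurable (ae_of_all _ fun p => ?_)
    rw [Real.norm_eq_abs, abs_of_pos (by positivity), ← Real.exp_add, ← Real.exp_add]
    exact Real.exp_le_exp.2 (by linarith [S.neg_cost_le p.1 p.2])
  have e₁ : ∀ x, ∫ y, Real.exp (-W x y - φ x - ψ y) ∂η = Real.exp (lse W η ψ x - φ x) := by
    intro x
    rw [sub_eq_add_neg, Real.exp_add, S.exp_lse hψ, mul_comm, ← integral_const_mul]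
    refine integral_congr_ae (ae_of_all _ fun y => ?_)
    simp only [← Real.exp_add]; ring_nf
  have e₂ : ∀ y, ∫ x, Real.exp (-W x y - φ x - ψ y) ∂μ = 1 := by
    intro y
    have : ∫ x, Real.exp (-W x y - φ x - ψ y) ∂μ
        = Real.exp (-ψ y) * ∫ x, Real.exp (-flat W y x - φ x) ∂μ := by
      rw [← integral_const_mul]
      refine integral_congr_ae (ae_of_all _ fun x => ?_)
      simp only [← Real.exp_add, flat]; ring_nf
    rw [this, ← S.symm.exp_lse hφ, ← Real.exp_add]
    simp [hψd]
  refine ⟨?_, ?_⟩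
  · simpa only [e₁] using iF.integral_prod_left
  · simp_rw [← e₁]
    rw [integral_integral_swap iF]
    simp_rw [e₂]; simp

/-- Apply t ≤ e^t - 1 to the logarithm of a density of total mass one. Along the iteration this is
the nonnegativity of the entropy of μ relative to π_{2n+1}. -/
lemma integral_lse_le (S : Sys μ η W g h k) (hφ : Integrable φ μ) (lφ : LowerPot η W k φ)
    (hψ : LowerPot μ (flat W) k (lse (flat W) μ φ))
    (hφ' : Integrable (lse W η (lse (flat W) μ φ)) μ) :
    ∫ x, lse W η (lse (flat W) μ φ) x ∂μ ≤ ∫ x, φ x ∂μ := by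
  have := S.prob_left
  obtain ⟨i, e⟩ := S.integral_exp_lse_sub lφ hψ
  have : ∫ x, (lse W η (lse (flat W) μ φ) x - φ x) ∂μ
      ≤ ∫ x, (Real.exp (lse W η (lse (flat W) μ φ) x - φ x) - 1) ∂μ :=
    integral_mono (hφ'.sub hφ) (i.sub (integrable_const 1)) fun x => by
      linarith [Real.add_one_le_exp (lse W η (lse (flat W) μ φ) x - φ x)]
  rw [integral_sub hφ' hφ, integral_sub i (integrable_const 1), e] at this
  simp at this
  linarith

end Sys

end System

/-! ### Uniform bounds along the normalized iteration, and stability of the log-partition map -/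

section Iteration

variable {X Y : Type*} [MeasurableSpace X] [MeasurableSpace Y]

/-- The normalized Sinkhorn iteration. -/
structure Iter (μ : Measure X) (η : Measure Y) (W : X → Y → ℝ) (φ : ℕ → X → ℝ)
    (ψ : ℕ → Y → ℝ) : Prop where
  zero : φ 0 = fun _ => 0
  right : ∀ n, ψ n = lse (flat W) μ (φ n)
  left : ∀ n, φ (n + 1) = lse W η (ψ n)

variable {μ : Measure X} {η : Measure Y} {W : X → Y → ℝ} {g : X → ℝ} {h : Y → ℝ} {k K : ℝ}

namespace Sys

/-- The bounds feed each other without loss. A lower bound on one potential gives the universal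
upper bound `K` on the next; the integral bound `k` gives the next lower bound by Jensen; and the
integrals do not increase. In the Jensen step `K` serves only integrability, so `k` does not
deteriorate with `n`. -/
lemma exists_adm (S : Sys μ η W g h k) {φ : ℕ → X → ℝ} {ψ : ℕ → Y → ℝ} (I : Iter μ η W φ ψ) :
    ∃ K : ℝ, 0 ≤ K ∧ ∀ n, Adm μ η W k K (φ n) ∧ Adm η μ (flat W) k K (ψ n) := by
  have := S.prob_left
  obtain ⟨K, K0, hK₁, hK₂⟩ : ∃ K : ℝ, 0 ≤ K ∧
      (∀ ψ, LowerPot μ (flat W) k ψ → ∀ x, lse W η ψ x ≤ K) ∧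
      (∀ φ, LowerPot η W k φ → ∀ y, lse (flat W) μ φ y ≤ K) :=
    ⟨max 0 (max _ _), le_max_left _ _,
      fun ψ hψ x => (S.lse_le hψ x).trans ((le_max_left _ _).trans (le_max_right _ _)),
      fun φ hφ y => (S.symm.lse_le hφ y).trans ((le_max_right _ _).trans (le_max_right _ _))⟩
  refine ⟨K, K0, fun n => ?_⟩
  induction n with
  | zero =>
    have h0 : Adm μ η W k K (φ 0) := by
      rw [I.zero]
      exact ⟨⟨measurable_const, fun x => by linarith [S.neg_mean_le x]⟩, fun _ => K0,
        by simpa using S.bound_nonneg⟩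
    refine ⟨h0, ?_⟩
    have hl := S.symm.lowerPot_lse h0
    -- The first potential on `Y` has no predecessor to be compared with; its integral bound comes
    -- from `φ 0 = 0` and -W ≤ k.
    have hk : ∀ y, lse (flat W) μ (φ 0) y ≤ k := fun y => by
      rw [← Real.exp_le_exp, S.symm.exp_lse h0.toLowerPot]
      calc _ ≤ ∫ _, Real.exp k ∂μ :=
            integral_mono (S.symm.integrable_ker h0.toLowerPot y) (integrable_const _) fun x => by
              refine Real.exp_le_exp.2 ?_
              rw [I.zero]
              simpa using S.symm.neg_cost_le y x
        _ = Real.exp k := by simp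
    rw [I.right]
    have := S.prob_right
    refine ⟨hl, hK₂ _ h0.toLowerPot, ?_⟩
    calc _ ≤ ∫ _, k ∂η := integral_mono (S.symm.integrable_of_le hl hk) (integrable_const _) hk
      _ = k := by simp
  | succ n ih =>
    obtain ⟨iφ, iψ⟩ := ih
    have hφ : Adm μ η W k K (φ (n + 1)) := by
      have hl := S.lowerPot_lse iψ
      rw [← I.left] at hl
      have hu : ∀ x, φ (n + 1) x ≤ K := by rw [I.left]; exact hK₁ _ iψ.toLowerPot
      refine ⟨hl, hu, ?_⟩
      have i := S.integrable_of_le hl hu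
      have l := iψ.toLowerPot
      have := S.integral_lse_le (S.integrable_adm iφ) iφ.toLowerPot (I.right n ▸ l)
        (by rw [← I.right, ← I.left]; exact i)
      rw [← I.right, ← I.left] at this
      exact this.trans iφ.integral_le
    refine ⟨hφ, ?_⟩
    have hl := S.symm.lowerPot_lse hφ
    rw [← I.right] at hl
    have hu : ∀ y, ψ (n + 1) y ≤ K := by rw [I.right]; exact hK₂ _ hφ.toLowerPot
    refine ⟨hl, hu, ?_⟩
    have i := S.symm.integrable_of_le hl hu
    have l := hφ.toLowerPot
    have := S.symm.integral_lse_le (S.symm.integrable_adm iψ) iψ.toLowerPot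
      (show LowerPot η W k (lse W η (ψ n)) from I.left n ▸ l)
      (by change Integrable (lse (flat W) μ (lse W η (ψ n))) η; rw [← I.left, ← I.right]; exact i)
    change ∫ y, lse (flat W) μ (lse W η (ψ n)) y ∂η ≤ _ at this
    rw [← I.left, ← I.right] at this
    exact this.trans iψ.integral_le

variable {ψ ψ' : Y → ℝ} {φ : X → ℝ}

lemma integrable_weight_mul_abs_exp_sub (S : Sys μ η W g h k) (hψ : LowerPot μ (flat W) k ψ)
    (hψ' : Measurable ψ') (hK : ∀ y, ψ' y ≤ K) :
    Integrable (fun y => h y * |Real.exp (ψ' y - ψ y) - 1|) η := by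
  refine (((S.symm.integrable_weight_mul_exp_neg hψ).const_mul (Real.exp K)).add
    S.symm.integrable_weight).mono'
    (S.right.meas_weight.mul ((hψ'.sub hψ.meas).exp.sub_const 1).abs).aestronglyMeasurable
    (ae_of_all _ fun y => ?_)
  have h0 := S.symm.weight_pos' y
  rw [Real.norm_eq_abs, abs_of_nonneg (by positivity)]
  have h1 : |Real.exp (ψ' y - ψ y) - 1| ≤ Real.exp (ψ' y - ψ y) + 1 := by
    rw [abs_le]; constructor <;> linarith [Real.exp_pos (ψ' y - ψ y)]
  have h2 : Real.exp (ψ' y - ψ y) ≤ Real.exp K * Real.exp (-ψ y) := by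
    rw [← Real.exp_add]; exact Real.exp_le_exp.2 (by linarith [hK y])
  calc h y * |Real.exp (ψ' y - ψ y) - 1|
      ≤ h y * (Real.exp K * Real.exp (-ψ y) + 1) := by gcongr; linarith
    _ = _ := by simp only [Pi.add_apply]; ring

/-- With a and b the two partition functions, log a - log b ≤ (a - b) / b, and 1 / b = e^{-lse ψ'}
is controlled by the lower bound on `lse W η ψ'`. -/
lemma lse_sub_le (S : Sys μ η W g h k) (hψ : LowerPot μ (flat W) k ψ)
    (hψ' : LowerPot μ (flat W) k ψ') (hφ : LowerPot η W k (lse W η ψ')) (x : X) :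
    lse W η ψ x - lse W η ψ' x ≤ (Real.exp k * Real.exp (∫ y, W x y ∂η)) *
      (Real.exp k * ∫ y, |Real.exp (-ψ y) - Real.exp (-ψ' y)| ∂η) := by
  set a := ∫ y, Real.exp (-W x y - ψ y) ∂η with ha
  set b := ∫ y, Real.exp (-W x y - ψ' y) ∂η with hb
  have a0 : 0 < a := S.integral_ker_pos hψ x
  have b0 : 0 < b := S.integral_ker_pos hψ' x
  have hab : a - b ≤ Real.exp k * ∫ y, |Real.exp (-ψ y) - Real.exp (-ψ' y)| ∂η := by
    rw [ha, hb, ← integral_sub (S.integrable_ker hψ x) (S.integrable_ker hψ' x),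
      ← integral_const_mul]
    refine integral_mono ((S.integrable_ker hψ x).sub (S.integrable_ker hψ' x))
      (((S.symm.integrable_exp_neg hψ).sub (S.symm.integrable_exp_neg hψ')).abs.const_mul _)
      fun y => ?_
    have : Real.exp (-W x y - ψ y) - Real.exp (-W x y - ψ' y)
        = Real.exp (-W x y) * (Real.exp (-ψ y) - Real.exp (-ψ' y)) := by
      rw [mul_sub, ← Real.exp_add, ← Real.exp_add]; ring_nf
    simp only [this]
    calc Real.exp (-W x y) * (Real.exp (-ψ y) - Real.exp (-ψ' y))
        ≤ Real.exp (-W x y) * |Real.exp (-ψ y) - Real.exp (-ψ' y)| := by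
          gcongr; exact le_abs_self _
      _ ≤ _ := by
          refine mul_le_mul_of_nonneg_right ?_ (abs_nonneg _)
          exact Real.exp_le_exp.2 (S.neg_cost_le x y)
  have h1 : lse W η ψ x - lse W η ψ' x ≤ a / b - 1 := by
    have := Real.log_le_sub_one_of_pos (div_pos a0 b0)
    rwa [Real.log_div a0.ne' b0.ne'] at this
  have h2 : a / b - 1 = Real.exp (-lse W η ψ' x) * (a - b) := by
    rw [Real.exp_neg, S.exp_lse hψ', ← hb]; field_simp
  rw [h2] at h1
  refine h1.trans ?_
  calc _ ≤ Real.exp (-lse W η ψ' x) *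
        (Real.exp k * ∫ y, |Real.exp (-ψ y) - Real.exp (-ψ' y)| ∂η) := by gcongr
    _ ≤ _ := by
      refine mul_le_mul_of_nonneg_right (S.exp_neg_le hφ x) ?_
      exact mul_nonneg (Real.exp_pos _).le (integral_nonneg fun _ => abs_nonneg _)

lemma abs_lse_sub_le (S : Sys μ η W g h k) (hψ : LowerPot μ (flat W) k ψ)
    (hψ' : LowerPot μ (flat W) k ψ') (hφ : LowerPot η W k (lse W η ψ))
    (hφ' : LowerPot η W k (lse W η ψ')) (x : X) :
    |lse W η ψ x - lse W η ψ' x| ≤ (Real.exp k * Real.exp (∫ y, W x y ∂η)) *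
      (Real.exp k * ∫ y, |Real.exp (-ψ y) - Real.exp (-ψ' y)| ∂η) := by
  rw [abs_le]
  refine ⟨?_, S.lse_sub_le hψ hψ' hφ' x⟩
  have := S.lse_sub_le hψ' hψ hφ x
  simp_rw [abs_sub_comm (Real.exp (-ψ' _))] at this
  linarith

/-- Stability of the log-partition function in the weighted norms. -/
lemma exists_abs_lse_sub_le (S : Sys μ η W g h k) : ∃ C : ℝ, 0 < C ∧ ∀ (K : ℝ) (ψ ψ' : Y → ℝ),
    LowerPot μ (flat W) k ψ → LowerPot μ (flat W) k ψ' → (∀ y, ψ' y ≤ K) →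
    LowerPot η W k (lse W η ψ) → LowerPot η W k (lse W η ψ') → ∀ x,
    |lse W η ψ' x - lse W η ψ x| ≤ C * (∫ y, h y * |Real.exp (ψ' y - ψ y) - 1| ∂η) * g x := by
  obtain ⟨C₁, C₁0, hC₁⟩ := S.exists_exp_mean_le
  obtain ⟨C₂, C₂0, hC₂⟩ := S.symm.exists_exp_mean_le
  refine ⟨(Real.exp k * C₁) * (Real.exp k * (Real.exp k * C₂)), by positivity,
    fun K ψ ψ' hψ hψ' hK hφ hφ' x => ?_⟩
  have g0 := S.weight_pos' x
  have i := S.integrable_weight_mul_abs_exp_sub hψ hψ'.meas hK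
  -- Factor out e^{-ψ'}, which is dominated by the weight `h`. What remains is the weighted L¹
  -- distance of the density e^{ψ'-ψ} from one, the quantity that the contraction controls.
  have key : ∫ y, |Real.exp (-ψ' y) - Real.exp (-ψ y)| ∂η
      ≤ (Real.exp k * C₂) * ∫ y, h y * |Real.exp (ψ' y - ψ y) - 1| ∂η := by
    rw [← integral_const_mul]
    refine integral_mono
      ((S.symm.integrable_exp_neg hψ').sub (S.symm.integrable_exp_neg hψ)).abs
      (i.const_mul _) fun y => ?_
    have : Real.exp (-ψ' y) - Real.exp (-ψ y)
        = -(Real.exp (-ψ' y) * (Real.exp (ψ' y - ψ y) - 1)) := by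
      rw [mul_sub, ← Real.exp_add, mul_one]; ring_nf
    simp only [this, abs_neg, abs_mul, Real.abs_exp]
    rw [← mul_assoc]
    refine mul_le_mul_of_nonneg_right ?_ (abs_nonneg _)
    refine (S.symm.exp_neg_le hψ' y).trans ?_
    rw [mul_assoc]
    exact mul_le_mul_of_nonneg_left (hC₂ y) (Real.exp_pos _).le
  refine (S.abs_lse_sub_le hψ' hψ hφ' hφ x).trans ?_
  calc _ ≤ (Real.exp k * (C₁ * g x)) * (Real.exp k * ((Real.exp k * C₂) *
        ∫ y, h y * |Real.exp (ψ' y - ψ y) - 1| ∂η)) := by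
        gcongr
        exact hC₁ x
    _ = _ := by ring

end Sys

end Iteration

/-! ### Drift, minorization and uniform contraction -/

section Contraction

variable {X Y : Type*} [MeasurableSpace X] [MeasurableSpace Y]
variable {μ : Measure X} {η : Measure Y} {W : X → Y → ℝ} {g : X → ℝ} {h : Y → ℝ} {k K : ℝ}

lemma integral_withDensity_ofReal {Z : Type*} [MeasurableSpace Z] {m : Measure Z} {p : Z → ℝ}
    (hp : Measurable p) (p0 : ∀ z, 0 ≤ p z) (f : Z → ℝ) :
    ∫ z, f z ∂(m.withDensity fun z => ENNReal.ofReal (p z)) = ∫ z, p z * f z ∂m := by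
  rw [integral_withDensity_eq_integral_toReal_smul hp.ennreal_ofReal
    (ae_of_all _ fun _ => ENNReal.ofReal_lt_top)]
  simp only [ENNReal.toReal_ofReal (p0 _), smul_eq_mul]

lemma integrable_withDensity_ofReal {Z : Type*} [MeasurableSpace Z] {m : Measure Z} {p : Z → ℝ}
    (hp : Measurable p) (p0 : ∀ z, 0 ≤ p z) {f : Z → ℝ} :
    Integrable f (m.withDensity fun z => ENNReal.ofReal (p z)) ↔
      Integrable (fun z => p z * f z) m := by
  rw [integrable_withDensity_iff_integrable_smul₀' hp.ennreal_ofReal.aemeasurable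
    (ae_of_all _ fun _ => ENNReal.ofReal_lt_top)]
  simp only [ENNReal.toReal_ofReal (p0 _), smul_eq_mul]

/-- Two densities that share the mass `α` on `D` have a small weighted distance. -/
lemma integral_sub_le_of_common_mass {m : Measure Y} [IsFiniteMeasure m] {p q f w : Y → ℝ}
    {D : Set Y} (hD : MeasurableSet D) {α : ℝ}
    (p0 : ∀ y, 0 ≤ p y) (q0 : ∀ y, 0 ≤ q y) (pD : ∀ y ∈ D, α ≤ p y) (qD : ∀ y ∈ D, α ≤ q y)
    (w0 : ∀ y, 1 / 2 ≤ w y) (hf : Measurable f) (fw : ∀ y, |f y| ≤ w y)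
    (ip : Integrable (fun y => p y * w y) m) (iq : Integrable (fun y => q y * w y) m)
    (mp : Measurable p) (mq : Measurable q) :
    ∫ y, p y * f y ∂m - ∫ y, q y * f y ∂m
      ≤ ∫ y, p y * w y ∂m + ∫ y, q y * w y ∂m - α * m.real D := by
  have fi : ∀ r : Y → ℝ, Measurable r → (∀ y, 0 ≤ r y) → Integrable (fun y => r y * w y) m →
      Integrable (fun y => r y * f y) m := fun r mr r0 ir =>
    ir.mono' (mr.mul hf).aestronglyMeasurable (ae_of_all _ fun y => by
      rw [Real.norm_eq_abs, abs_mul, abs_of_nonneg (r0 y)]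
      exact mul_le_mul_of_nonneg_left (fw y) (r0 y))
  have iD : Integrable (D.indicator fun _ => α) m := (integrable_const α).indicator hD
  have eD : ∫ y, D.indicator (fun _ => α) y ∂m = α * m.real D := by
    rw [integral_indicator_const _ hD, smul_eq_mul, mul_comm]
  have ipq : Integrable (fun y => p y * w y + q y * w y) m := ip.add iq
  rw [← eD, ← integral_sub (fi p mp p0 ip) (fi q mq q0 iq), ← integral_add ip iq,
    ← integral_sub ipq iD]
  refine integral_mono ((fi p mp p0 ip).sub (fi q mq q0 iq)) (ipq.sub iD) fun y => ?_
  obtain ⟨f1, f2⟩ := abs_le.1 (fw y)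
  have := w0 y
  have hp := p0 y
  have hq := q0 y
  by_cases hy : y ∈ D
  · have h1 := pD y hy
    have h2 := qD y hy
    simp only [Set.indicator_of_mem hy]
    -- Here (p - q) f ≤ |p - q| w = (p + q) w - 2 min(p, q) w, with w ≥ 1/2 and min(p, q) ≥ α on
    -- `D`.
    rcases le_total (p y) (q y) with hpq | hpq <;> nlinarith
  · simp only [Set.indicator_of_notMem hy]
    nlinarith

namespace Sys

/-- The lower bounds dominate the transition density by a product of a function of `x` and a
function of `y`. Integrating `h` leaves a multiple of the exponential mean cost at `x`, which is at
most any small multiple of `g` plus a constant. The potentials enter only through their lower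
bounds, so `c` is uniform. -/
lemma exists_drift (S : Sys μ η W g h k) : ∃ c : ℝ, 0 ≤ c ∧ ∀ (φ : X → ℝ) (ψ : Y → ℝ),
    LowerPot η W k φ → LowerPot μ (flat W) k ψ → ∀ x,
    Integrable (fun y => Real.exp (-W x y - φ x - ψ y) * h y) η ∧
    ∫ y, Real.exp (-W x y - φ x - ψ y) * h y ∂η ≤ 1 / 2 * g x + c := by
  set H := ∫ y, h y * Real.exp (∫ x, W x y ∂μ) ∂η with hH
  have H0 : 0 ≤ H := integral_nonneg fun y =>
    mul_nonneg (S.symm.weight_pos' y).le (Real.exp_pos _).le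
  set B := Real.exp k * (Real.exp k * Real.exp k) * H with hB
  have B0 : 0 ≤ B := by positivity
  -- This makes the slope B / (2 (B + 1)) at most 1/2; the summand 1 covers the case `B = 0`.
  obtain ⟨c, hc⟩ := S.left.drift (1 / (2 * (B + 1))) (by positivity)
  refine ⟨B * |c|, by positivity, fun φ ψ hφ hψ x => ?_⟩
  have bound : ∀ y, Real.exp (-W x y - φ x - ψ y) * h y ≤
      (Real.exp (∫ y, W x y ∂η) * (Real.exp k * (Real.exp k * Real.exp k))) *
        (h y * Real.exp (∫ x, W x y ∂μ)) := fun y => by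
    have h0 := S.symm.weight_pos' y
    have e₁ := S.exp_neg_le hφ x
    have e₂ := S.symm.exp_neg_le hψ y
    have e₃ := Real.exp_le_exp.2 (S.neg_cost_le x y)
    calc Real.exp (-W x y - φ x - ψ y) * h y
        = Real.exp (-W x y) * Real.exp (-φ x) * Real.exp (-ψ y) * h y := by
          rw [← Real.exp_add, ← Real.exp_add]; ring_nf
      _ ≤ Real.exp k * (Real.exp k * Real.exp (∫ y, W x y ∂η)) *
          (Real.exp k * Real.exp (∫ x, W x y ∂μ)) * h y := by gcongr; exact e₂
      _ = _ := by ring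
  have iB := S.symm.integrable_weight_mul_exp_mean.const_mul
    (Real.exp (∫ y, W x y ∂η) * (Real.exp k * (Real.exp k * Real.exp k)))
  have i : Integrable (fun y => Real.exp (-W x y - φ x - ψ y) * h y) η := by
    refine iB.mono' ((((S.meas_section x).neg.sub_const _).sub hψ.meas).exp.mul
      S.right.meas_weight).aestronglyMeasurable (ae_of_all _ fun y => ?_)
    have h0 := S.symm.weight_pos' y
    rw [Real.norm_eq_abs, abs_of_pos (by positivity)]
    exact bound y
  refine ⟨i, (integral_mono i iB bound).trans ?_⟩
  rw [integral_const_mul]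
  have g0 := S.weight_pos' x
  calc _ = B * Real.exp (∫ y, W x y ∂η) := by rw [hB]; simp only [flat, hH]; ring
    _ ≤ B * (1 / (2 * (B + 1)) * g x + |c|) := by
      gcongr; exact (hc x).trans (by linarith [le_abs_self c])
    _ = (B / (B + 1)) * (1 / 2 * g x) + B * |c| := by field_simp
    _ ≤ 1 * (1 / 2 * g x) + B * |c| := by
      gcongr; exact (div_le_one (by positivity)).2 (by linarith)
    _ = _ := by ring

/-- Only upper bounds on the cost and on the potentials are needed, so `D` and `α` serve the whole
class. -/
lemma exists_minor (S : Sys μ η W g h k) (K r : ℝ) : ∃ D : Set Y, MeasurableSet D ∧ 0 < η D ∧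
    ∃ α : ℝ, 0 < α ∧ ∀ (φ : X → ℝ) (ψ : Y → ℝ), (∀ x, φ x ≤ K) → (∀ y, ψ y ≤ K) →
      ∀ x, g x ≤ r → ∀ y ∈ D, α ≤ Real.exp (-W x y - φ x - ψ y) := by
  obtain ⟨D, mD, D0, M, hM⟩ := S.left.minor r
  refine ⟨D, mD, D0, Real.exp (-M - K - K), Real.exp_pos _, fun φ ψ hφ hψ x hx y hy => ?_⟩
  exact Real.exp_le_exp.2 (by linarith [hM x hx y hy, hφ x, hψ y])

/-- A kernel is the Gibbs transition with potentials `φ`, `ψ`. -/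
def IsGibbs (L : Kernel X Y) (η : Measure Y) (W : X → Y → ℝ) (φ : X → ℝ) (ψ : Y → ℝ) : Prop :=
  ∀ x, L x = η.withDensity fun y => ENNReal.ofReal (Real.exp (-W x y - φ x - ψ y))

/-- Uniform contraction of all Gibbs transitions with potentials in the admissible class. -/
lemma exists_contraction (S : Sys μ η W g h k) (K : ℝ) : ∃ a₀ : ℝ, 0 < a₀ ∧
    ∀ a, 0 < a → a ≤ a₀ → ∃ ρ₀ : ℝ, ρ₀ < 1 ∧ ∀ ρ, ρ₀ ≤ ρ →
      ∀ (L : Kernel X Y) (φ : X → ℝ) (ψ : Y → ℝ), IsMarkovKernel L →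
        LowerPot η W k φ → LowerPot μ (flat W) k ψ → (∀ x, φ x ≤ K) → (∀ y, ψ y ≤ K) →
        IsGibbs L η W φ ψ →
        lip (fun x => 1 / 2 + a * g x) (fun y => 1 / 2 + a * h y) L ≤ ENNReal.ofReal ρ := by
  have := S.prob_right
  obtain ⟨c, c0, hdrift⟩ := S.exists_drift
  -- Let S = g x + g x'. If S exceeds 8c + 8, the drift alone suffices: a + 2ac ≤ aS/4. Otherwise
  -- both points lie in the sub-level set at height 8c + 8, where the minorization applies.
  obtain ⟨D, mD, D0, α, α0, hα⟩ := S.exists_minor K (8 * c + 8)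
  set β := α * η.real D with hβ
  have β0 : 0 < β := mul_pos α0 (ENNReal.toReal_pos D0.ne' (measure_ne_top _ _))
  -- For such `a` the drift constant 2ac costs at most half of the common mass `β`.
  refine ⟨β / (4 * (c + 1)), by positivity, fun a a0 ha => ?_⟩
  have ha' : 2 * (a * c) ≤ β / 2 := by
    rw [le_div_iff₀ (by positivity)] at ha
    nlinarith
  -- The bound 3/4 leaves room above the drift slope 1/2; 1 - a is used for distant points and 1 -
  -- β/2 for close ones.
  refine ⟨max (3 / 4) (max (1 - a) (1 - β / 2)), ?_, ?_⟩
  · refine max_lt (by norm_num) (max_lt (by linarith) (by linarith))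
  intro ρ hρ L φ ψ _ hφ hψ hφK hψK hL
  have ρ1 : 3 / 4 ≤ ρ := (le_max_left _ _).trans hρ
  have ρ2 : 1 - a ≤ ρ := (le_max_left _ _).trans ((le_max_right _ _).trans hρ)
  have ρ3 : 1 - β / 2 ≤ ρ := (le_max_right _ _).trans ((le_max_right _ _).trans hρ)
  have g0 := fun x => (S.weight_pos' x).le
  have h0 := fun y => (S.symm.weight_pos' y).le
  have mp : ∀ x, Measurable fun y => Real.exp (-W x y - φ x - ψ y) := fun x =>
    (((S.meas_section x).neg.sub_const _).sub hψ.meas).exp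
  have p0 : ∀ x y, 0 ≤ Real.exp (-W x y - φ x - ψ y) := fun x y => (Real.exp_pos _).le
  have eL : ∀ (f : Y → ℝ) x, ∫ y, f y ∂(L x) = ∫ y, Real.exp (-W x y - φ x - ψ y) * f y ∂η :=
    fun f x => by rw [hL x, integral_withDensity_ofReal (mp x) (p0 x)]
  have iL : ∀ (f : Y → ℝ) x, Integrable f (L x) ↔
      Integrable (fun y => Real.exp (-W x y - φ x - ψ y) * f y) η :=
    fun f x => by rw [hL x, integrable_withDensity_ofReal (mp x) (p0 x)]
  have ih : ∀ x, Integrable h (L x) := fun x => (iL h x).2 (hdrift φ ψ hφ hψ x).1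
  have bh : ∀ x, ∫ y, h y ∂(L x) ≤ 1 / 2 * g x + c := fun x => by
    rw [eL]; exact (hdrift φ ψ hφ hψ x).2
  have iw : ∀ x, Integrable (fun y => 1 / 2 + a * h y) (L x) := fun x =>
    (integrable_const _).add ((ih x).const_mul a)
  have ew : ∀ x, ∫ y, (1 / 2 + a * h y) ∂(L x) = 1 / 2 + a * ∫ y, h y ∂(L x) := fun x => by
    rw [integral_add (integrable_const _) ((ih x).const_mul a), integral_const_mul]; simp
  -- This `C` only ensures integrability; it does not affect the rate.
  refine lip_le (C := 1 + 2 * a * c) ((S.left.meas_weight.const_mul a).const_add _)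
    ((S.right.meas_weight.const_mul a).const_add _) (fun x => by have := g0 x; positivity)
    (fun y => by have := h0 y; positivity) iw (fun x => ?_) (by linarith) ?_
  · rw [ew]
    nlinarith [bh x, g0 x, mul_nonneg a0.le (g0 x), mul_nonneg a0.le c0,
      mul_nonneg (mul_nonneg a0.le c0) (mul_nonneg a0.le (g0 x)),
      mul_le_mul_of_nonneg_left (bh x) a0.le]
  intro f mf bf x x'
  -- Used with `E = D` for close points and with the empty set for distant ones.
  have base : ∀ (E : Set Y) (γ : ℝ), MeasurableSet E →
      (∀ y ∈ E, γ ≤ Real.exp (-W x y - φ x - ψ y)) →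
      (∀ y ∈ E, γ ≤ Real.exp (-W x' y - φ x' - ψ y)) →
      ∫ y, f y ∂(L x) - ∫ y, f y ∂(L x')
        ≤ 1 + a * (1 / 2 * (g x + g x') + 2 * c) - γ * η.real E := by
    intro E γ mE h1 h2
    have := integral_sub_le_of_common_mass (m := η) mE (p0 x) (p0 x') h1 h2
      (w := fun y => 1 / 2 + a * h y) (fun y => by nlinarith [h0 y]) mf bf
      ((iL _ x).1 (iw x)) ((iL _ x').1 (iw x')) (mp x) (mp x')
    rw [← eL, ← eL, ← eL, ← eL, ew, ew] at this
    nlinarith [mul_le_mul_of_nonneg_left (bh x) a0.le, mul_le_mul_of_nonneg_left (bh x') a0.le]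
  have aS : 0 ≤ a * (g x + g x') := mul_nonneg a0.le (add_nonneg (g0 x) (g0 x'))
  have target : ρ * (1 / 2 + a * g x + (1 / 2 + a * g x')) = ρ + ρ * (a * (g x + g x')) := by ring
  rw [target]
  by_cases hS : g x + g x' ≤ 8 * c + 8
  · have := base D α mD (hα φ ψ hφK hψK x (by linarith [g0 x']))
      (hα φ ψ hφK hψK x' (by linarith [g0 x]))
    rw [← hβ] at this
    nlinarith [mul_le_mul_of_nonneg_right ρ1 aS]
  · have := base ∅ 0 MeasurableSet.empty (by simp) (by simp)
    nlinarith [mul_le_mul_of_nonneg_right ρ1 aS, mul_le_mul_of_nonneg_left (not_le.1 hS).le a0.le]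

end Sys

end Contraction

/-! ### Relative entropy of exponential densities and the Schrödinger bridge -/

section Entropy

open InformationTheory

variable {Z : Type*} [MeasurableSpace Z] {P Q : Measure Z} {f : Z → ℝ}

/-- Because `Q` has mass one, the normalization of the exponential tilt is one, and entropy formulas
for tilted measures apply to `Q`. -/
lemma tilted_eq_withDensity_exp (hf : Measurable f)
    (hQ : Q = P.withDensity fun z => ENNReal.ofReal (Real.exp (f z))) [IsProbabilityMeasure Q] :
    Integrable (fun z => Real.exp (f z)) P ∧ ∫ z, Real.exp (f z) ∂P = 1 ∧ P.tilted f = Q := by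
  have h1 : ∫⁻ z, ENNReal.ofReal (Real.exp (f z)) ∂P = 1 := by
    rw [← setLIntegral_univ, ← withDensity_apply _ MeasurableSet.univ, ← hQ, measure_univ]
  have i : Integrable (fun z => Real.exp (f z)) P := by
    refine ⟨hf.exp.aestronglyMeasurable, ?_⟩
    rw [hasFiniteIntegral_iff_ofReal (ae_of_all _ fun _ => (Real.exp_pos _).le), h1]
    exact ENNReal.one_lt_top
  have e : ∫ z, Real.exp (f z) ∂P = 1 := by
    rw [integral_eq_lintegral_of_nonneg_ae (ae_of_all _ fun _ => (Real.exp_pos _).le)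
      hf.exp.aestronglyMeasurable, h1, ENNReal.toReal_one]
  refine ⟨i, e, ?_⟩
  rw [hQ, Measure.tilted, e]
  simp only [div_one]

lemma klDiv_withDensity_exp [IsProbabilityMeasure P] [IsProbabilityMeasure Q] (hf : Measurable f)
    (hQ : Q = P.withDensity fun z => ENNReal.ofReal (Real.exp (f z))) (hi : Integrable f Q) :
    klDiv Q P = ENNReal.ofReal (∫ z, f z ∂Q) := by
  obtain ⟨i, e, t⟩ := tilted_eq_withDensity_exp hf hQ
  have ac : Q ≪ P := t ▸ tilted_absolutelyContinuous P f
  have hl : llr Q P =ᵐ[Q] f := by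
    have := log_rnDeriv_tilted_left_self i
    rw [t, e] at this
    filter_upwards [ac.ae_le this] with z hz
    simpa [llr] using hz
  rw [klDiv_of_ac_of_integrable ac (hi.congr hl.symm), integral_congr_ae hl]
  simp

/-- Chain rule: log dR/dP = log dR/dQ + f, integrated under `R`. -/
lemma integral_llr_eq_klDiv_add [IsProbabilityMeasure P] [IsProbabilityMeasure Q]
    (hf : Measurable f) (hQ : Q = P.withDensity fun z => ENNReal.ofReal (Real.exp (f z)))
    {R : Measure Z} [IsProbabilityMeasure R] (hR : R ≪ P) (hl : Integrable (llr R P) R)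
    (hi : Integrable f R) :
    klDiv R P = ENNReal.ofReal ((klDiv R Q).toReal + ∫ z, f z ∂ R) ∧ klDiv R Q ≠ ∞ := by
  obtain ⟨i, e, t⟩ := tilted_eq_withDensity_exp hf hQ
  have ac : R ≪ Q := hR.trans (t ▸ absolutelyContinuous_tilted i)
  have i' : Integrable (llr R Q) R := t ▸ integrable_llr_tilted_right hR hi hl i
  have e' := integral_llr_tilted_right hR hi i hl
  rw [t, e] at e'
  refine ⟨?_, klDiv_ne_top ac i'⟩
  rw [klDiv_of_ac_of_integrable hR hl, toReal_klDiv_of_measure_eq ac (by simp), e']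
  simp

variable {X Y : Type*} [MeasurableSpace X] [MeasurableSpace Y]

lemma IsCoupling.isProbabilityMeasure {μ : Measure X} {η : Measure Y} [IsProbabilityMeasure μ]
    {R : Measure (X × Y)} (hR : IsCoupling μ η R) : IsProbabilityMeasure R := by
  constructor
  rw [← Measure.fst_univ, hR.1, measure_univ]

lemma IsCoupling.integral_add {μ : Measure X} {η : Measure Y} {R : Measure (X × Y)}
    (hR : IsCoupling μ η R) {α : X → ℝ} {β : Y → ℝ} (hα : Integrable α μ) (hβ : Integrable β η) :
    Integrable (fun p : X × Y => α p.1 + β p.2) R ∧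
    ∫ p, (α p.1 + β p.2) ∂ R = ∫ x, α x ∂μ + ∫ y, β y ∂η := by
  obtain ⟨rfl, rfl⟩ := hR
  have i₁ : Integrable (fun p : X × Y => α p.1) R := hα.comp_measurable measurable_fst
  have i₂ : Integrable (fun p : X × Y => β p.2) R := hβ.comp_measurable measurable_snd
  refine ⟨i₁.add i₂, ?_⟩
  rw [MeasureTheory.integral_add i₁ i₂, Measure.fst, Measure.snd,
    integral_map measurable_fst.aemeasurable hα.aestronglyMeasurable,
    integral_map measurable_snd.aemeasurable hβ.aestronglyMeasurable]

/-- A coupling whose log-density splits as a sum of integrable functions of the coordinates is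
the unique Schrödinger bridge. -/
lemma isSchrodingerBridge_of_density {μ : Measure X} {η : Measure Y} [IsProbabilityMeasure μ]
    {P Q : Measure (X × Y)} [IsProbabilityMeasure P] {α : X → ℝ} {β : Y → ℝ}
    (mα : Measurable α) (mβ : Measurable β) (hα : Integrable α μ) (hβ : Integrable β η)
    (hQ : IsCoupling μ η Q)
    (hd : Q = P.withDensity fun p => ENNReal.ofReal (Real.exp (α p.1 + β p.2))) :
    IsSchrodingerBridge P μ η Q ∧ ∀ R, IsSchrodingerBridge P μ η R → R = Q := by
  have := hQ.isProbabilityMeasure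
  have mf : Measurable fun p : X × Y => α p.1 + β p.2 :=
    (mα.comp measurable_fst).add (mβ.comp measurable_snd)
  set c := ∫ x, α x ∂μ + ∫ y, β y ∂η with hc
  have kQ : klDiv Q P = ENNReal.ofReal c := by
    rw [klDiv_withDensity_exp mf hd (hQ.integral_add hα hβ).1, (hQ.integral_add hα hβ).2]
  -- The formula `kQ` truncates at zero and does not give the sign. It is needed below to compare
  -- real numbers from an inequality between their `ENNReal.ofReal`.
  have c0 : 0 ≤ c := by
    obtain ⟨i, e, t⟩ := tilted_eq_withDensity_exp mf hd
    have hl : Integrable (fun p : X × Y => α p.1 + β p.2) Q := (hQ.integral_add hα hβ).1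
    have ac : Q ≪ P := t ▸ tilted_absolutelyContinuous P _
    have hne : klDiv Q P ≠ ∞ := by rw [kQ]; exact ENNReal.ofReal_ne_top
    have h := integral_llr_tilted_right ac hl i (klDiv_ne_top_iff.1 hne).2
    rw [t, e, (hQ.integral_add hα hβ).2] at h
    have h2 := toReal_klDiv_of_measure_eq (μ := Q) (ν := P) ac (by simp)
    have h3 : ∫ p, llr Q Q p ∂Q = 0 := by
      rw [integral_congr_ae (llr_self Q)]; simp
    rw [h3, ← h2, Real.log_one] at h
    have := ENNReal.toReal_nonneg (a := klDiv Q P)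
    linarith
  -- The integral of a sum of coordinate functions depends only on the marginals, so the additive
  -- term is `c` for every coupling.
  have key : ∀ R, IsCoupling μ η R → klDiv R P ≠ ∞ →
      klDiv R P = ENNReal.ofReal ((klDiv R Q).toReal + c) ∧ klDiv R Q ≠ ∞ := by
    intro R hR hne
    have := hR.isProbabilityMeasure
    obtain ⟨ac, il⟩ := klDiv_ne_top_iff.1 hne
    have := integral_llr_eq_klDiv_add mf hd ac il (hR.integral_add hα hβ).1
    rwa [(hR.integral_add hα hβ).2] at this
  refine ⟨⟨hQ, fun R hR => ?_⟩, fun R hR => ?_⟩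
  · by_cases hne : klDiv R P = ∞
    · rw [hne]; exact le_top
    · rw [kQ, (key R hR hne).1]
      exact ENNReal.ofReal_le_ofReal (le_add_of_nonneg_left ENNReal.toReal_nonneg)
  · have := hR.1.isProbabilityMeasure
    have hle := hR.2 Q hQ
    have hne : klDiv R P ≠ ∞ := ne_top_of_le_ne_top (by rw [kQ]; exact ENNReal.ofReal_ne_top) hle
    obtain ⟨e, ne⟩ := key R hR.1 hne
    rw [e, kQ, ENNReal.ofReal_le_ofReal_iff c0] at hle
    have h0 : (klDiv R Q).toReal = 0 :=
      le_antisymm (by linarith) ENNReal.toReal_nonneg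
    exact klDiv_eq_zero_iff.1 ((ENNReal.toReal_eq_zero_iff _).1 h0 |>.resolve_right ne)

end Entropy

/-! ### Gibbs measures and tilted transitions -/

section Gibbs

variable {X Y : Type*} [MeasurableSpace X] [MeasurableSpace Y]

/-- The measure `e^{-u(x) - W(x,y) - v(y)} lam(dx) nu(dy)`. -/
def joint (lam : Measure X) (nu : Measure Y) (W : X → Y → ℝ) (u : X → ℝ) (v : Y → ℝ) :
    Measure (X × Y) :=
  (lam.prod nu).withDensity fun p => ENNReal.ofReal (Real.exp (-u p.1 - W p.1 p.2 - v p.2))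

lemma measurable_fun_sub {a b : X → ℝ} (ha : Measurable a) (hb : Measurable b) :
    Measurable fun x => a x - b x := ha.sub hb

lemma measurable_exp_neg {a : X → ℝ} (ha : Measurable a) : Measurable fun x => Real.exp (-a x) :=
  ha.neg.exp

lemma gibbs_withDensity {m : Measure X} {a b : X → ℝ} (ha : Measurable a) (hb : Measurable b) :
    (gibbs m a).withDensity (fun x => ENNReal.ofReal (Real.exp (b x)))
      = gibbs m (fun x => a x - b x) := by
  unfold gibbs
  have m₁ : Measurable fun x => ENNReal.ofReal (Real.exp (-a x)) := ha.neg.exp.ennreal_ofReal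
  have m₂ : Measurable fun x => ENNReal.ofReal (Real.exp (b x)) := hb.exp.ennreal_ofReal
  rw [← withDensity_mul _ m₁ m₂]
  congr 1; funext x
  rw [Pi.mul_apply, ← ENNReal.ofReal_mul (Real.exp_pos _).le, ← Real.exp_add]
  ring_nf

variable {lam : Measure X} {nu : Measure Y} {W : X → Y → ℝ}

lemma measurable_joint_density (hW : Measurable (Function.uncurry W)) {u : X → ℝ} {v : Y → ℝ}
    (hu : Measurable u) (hv : Measurable v) :
    Measurable fun p : X × Y => Real.exp (-u p.1 - W p.1 p.2 - v p.2) :=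
  (((hu.comp measurable_fst).neg.sub hW).sub (hv.comp measurable_snd)).exp

lemma joint_withDensity (hW : Measurable (Function.uncurry W)) {u u' : X → ℝ} {v v' : Y → ℝ}
    (hu : Measurable u) (hv : Measurable v) (hu' : Measurable u') (hv' : Measurable v') :
    joint lam nu W u' v' = (joint lam nu W u v).withDensity
      (fun p => ENNReal.ofReal (Real.exp ((u p.1 - u' p.1) + (v p.2 - v' p.2)))) := by
  unfold joint
  have m : Measurable fun p : X × Y =>
      ENNReal.ofReal (Real.exp ((u p.1 - u' p.1) + (v p.2 - v' p.2))) :=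
    (((hu.sub hu').comp measurable_fst).add ((hv.sub hv').comp measurable_snd)).exp.ennreal_ofReal
  rw [← withDensity_mul _ (measurable_joint_density hW hu hv).ennreal_ofReal m]
  congr 1; funext p
  rw [Pi.mul_apply, ← ENNReal.ofReal_mul (Real.exp_pos _).le, ← Real.exp_add]
  ring_nf

variable [SFinite lam] [SFinite nu]

lemma joint_map_swap (hW : Measurable (Function.uncurry W)) {u : X → ℝ} {v : Y → ℝ}
    (hu : Measurable u) (hv : Measurable v) :
    (joint nu lam (flat W) v u).map Prod.swap = joint lam nu W u v := by
  have m : Measurable fun p : Y × X => Real.exp (-v p.1 - flat W p.1 p.2 - u p.2) :=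
    measurable_joint_density (W := flat W) (hW.comp measurable_swap) hv hu
  refine Measure.ext_of_lintegral _ fun f hf => ?_
  have fs : Measurable fun p : Y × X => f p.swap := hf.comp measurable_swap
  rw [lintegral_map hf measurable_swap]
  unfold joint
  rw [lintegral_withDensity_eq_lintegral_mul _ m.ennreal_ofReal fs,
    lintegral_withDensity_eq_lintegral_mul _ (measurable_joint_density hW hu hv).ennreal_ofReal hf,
    ← Measure.prod_swap,
    lintegral_map (m.ennreal_ofReal.mul fs) measurable_swap]
  refine lintegral_congr fun p => ?_
  simp only [Pi.mul_apply, Prod.swap, flat]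
  congr 3; ring

/-- `v` is admissible for the integral operator with kernel `e^{-W(x,y)} nu(dy)`, and `w` is the
logarithm of the resulting function. -/
structure LogOp (nu : Measure Y) (W : X → Y → ℝ) (v : Y → ℝ) (w : X → ℝ) : Prop where
  meas_right : Measurable v
  meas_left : Measurable w
  integrable : ∀ x, Integrable (fun y => Real.exp (-W x y) * Real.exp (-v y)) nu
  exp_eq : ∀ x, Real.exp (w x) = op W nu (fun y => Real.exp (-v y)) x

variable {v : Y → ℝ} {w : X → ℝ}

lemma tilted_apply (hW : Measurable (Function.uncurry W)) (H : LogOp nu W v w) (x : X) :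
    tilted W nu v x = nu.withDensity fun y => ENNReal.ofReal (Real.exp (-W x y - v y - w x)) := by
  have e : (fun x y => ENNReal.ofReal (Real.exp (-W x y) * Real.exp (-v y) /
      op W nu (fun z => Real.exp (-v z)) x)) =
      fun x y => ENNReal.ofReal (Real.exp (-W x y - v y - w x)) := by
    funext x y
    rw [← H.exp_eq, Real.exp_sub, sub_eq_add_neg, Real.exp_add]
  unfold tilted
  rw [e, Kernel.withDensity_apply, Kernel.const_apply]
  exact ((hW.neg.sub (H.meas_right.comp measurable_snd)).sub
    (H.meas_left.comp measurable_fst)).exp.ennreal_ofReal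

lemma isMarkovKernel_tilted (hW : Measurable (Function.uncurry W)) (H : LogOp nu W v w) :
    IsMarkovKernel (tilted W nu v) := by
  refine ⟨fun x => ⟨?_⟩⟩
  rw [tilted_apply hW H, withDensity_apply _ MeasurableSet.univ, setLIntegral_univ]
  have e : ∀ y, Real.exp (-W x y - v y - w x)
      = Real.exp (-W x y) * Real.exp (-v y) / op W nu (fun z => Real.exp (-v z)) x := by
    intro y
    rw [← H.exp_eq, Real.exp_sub, sub_eq_add_neg, Real.exp_add]
  simp_rw [e]
  rw [← ofReal_integral_eq_lintegral_ofReal ((H.integrable x).div_const _)]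
  · rw [integral_div]
    have : op W nu (fun z => Real.exp (-v z)) x ≠ 0 := by
      rw [← H.exp_eq]; exact (Real.exp_pos _).ne'
    rw [show ∫ y, Real.exp (-W x y) * Real.exp (-v y) ∂nu
      = op W nu (fun z => Real.exp (-v z)) x from rfl, div_self this, ENNReal.ofReal_one]
  · exact ae_of_all _ fun y => (Real.exp_pos _).le.trans_eq (e y)

lemma sFinite_gibbs (u : X → ℝ) : SFinite (gibbs lam u) := by
  unfold gibbs; infer_instance

/-- The normalization depends on `x` only and joins the first potential. Every bridge thus becomes a
measure `joint`, and the conditioning recursions become identities between potentials. -/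
lemma compProd_tilted (hW : Measurable (Function.uncurry W)) (H : LogOp nu W v w) {u : X → ℝ}
    (hu : Measurable u) :
    (gibbs lam u).compProd (tilted W nu v) = joint lam nu W (fun x => u x + w x) v := by
  have := isMarkovKernel_tilted hW H
  have := sFinite_gibbs (lam := lam) u
  refine Measure.ext_of_lintegral _ fun f hf => ?_
  have mJ := measurable_joint_density hW (u := fun x => u x + w x) (hu.add H.meas_left)
    H.meas_right
  have mu : Measurable fun x => ENNReal.ofReal (Real.exp (-u x)) := hu.neg.exp.ennreal_ofReal
  rw [Measure.lintegral_compProd hf]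
  unfold joint gibbs
  rw [lintegral_withDensity_eq_lintegral_mul _ mu
      hf.lintegral_kernel_prod_right',
    lintegral_withDensity_eq_lintegral_mul _ mJ.ennreal_ofReal hf,
    lintegral_prod _ (mJ.ennreal_ofReal.mul hf).aemeasurable]
  refine lintegral_congr fun x => ?_
  have mx : Measurable fun y => Real.exp (-W x y - v y - w x) :=
    (((hW.comp measurable_prodMk_left).neg.sub H.meas_right).sub_const _).exp
  have fx : Measurable fun y => f (x, y) := hf.comp measurable_prodMk_left
  rw [Pi.mul_apply, tilted_apply hW H,
    lintegral_withDensity_eq_lintegral_mul _ mx.ennreal_ofReal fx,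
    ← lintegral_const_mul _ (mx.ennreal_ofReal.mul fx)]
  refine lintegral_congr fun y => ?_
  simp only [Pi.mul_apply]
  rw [← mul_assoc, ← ENNReal.ofReal_mul (Real.exp_pos _).le, ← Real.exp_add]
  congr 3; ring

/-- Writing u = (u - w) + w disintegrates the measure into a Gibbs measure followed by a Markov
kernel. -/
lemma joint_fst (hW : Measurable (Function.uncurry W)) (H : LogOp nu W v w) {u : X → ℝ}
    (hu : Measurable u) :
    (joint lam nu W u v).fst = gibbs lam (fun x => u x - w x) := by
  have := isMarkovKernel_tilted hW H
  have := sFinite_gibbs (lam := lam) (fun x => u x - w x)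
  have h := compProd_tilted (lam := lam) hW H (u := fun x => u x - w x) (hu.sub H.meas_left)
  simp only [sub_add_cancel] at h
  rw [← h, Measure.fst_compProd]

lemma joint_snd (hW : Measurable (Function.uncurry W)) {u : X → ℝ} {z : Y → ℝ}
    (H : LogOp lam (flat W) u z) (hv : Measurable v) :
    (joint lam nu W u v).snd = gibbs nu (fun y => v y - z y) := by
  rw [← joint_map_swap hW H.meas_right hv, Measure.snd_map_swap]
  exact joint_fst (W := flat W) (hW.comp measurable_swap) H hv

end Gibbs

/-! ### From the topological hypotheses to the normalized system -/

section Topological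

variable {X Y : Type*} [TopologicalSpace X] [TopologicalSpace Y]

lemma LocallyBounded.exists_bound {f : X → ℝ} (hf : LocallyBounded f) {s : Set X}
    (hs : IsCompact s) : ∃ M : ℝ, 0 ≤ M ∧ ∀ x ∈ s, |f x| ≤ M := by
  refine hs.induction_on (p := fun s => ∃ M : ℝ, 0 ≤ M ∧ ∀ x ∈ s, |f x| ≤ M)
    ⟨0, le_rfl, by simp⟩ ?_ ?_ ?_
  · rintro s t hst ⟨M, M0, hM⟩
    exact ⟨M, M0, fun x hx => hM x (hst hx)⟩
  · rintro s t ⟨M, M0, hM⟩ ⟨N, _, hN⟩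
    refine ⟨max M N, le_max_of_le_left M0, fun x hx => ?_⟩
    rcases hx with hx | hx
    · exact (hM x hx).trans (le_max_left _ _)
    · exact (hN x hx).trans (le_max_right _ _)
  · intro x _
    obtain ⟨s, hs, C, hC⟩ := hf x
    exact ⟨s, mem_nhdsWithin_of_mem_nhds hs, max C 0, le_max_right _ _,
      fun w hw => (hC w hw).trans (le_max_left _ _)⟩

lemma LocallyBounded.exists_lower_bound {f : X → ℝ} (hf : LocallyBounded f)
    (hc : CompactSublevels f) : ∃ M : ℝ, 0 ≤ M ∧ ∀ x, -M ≤ f x := by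
  obtain ⟨M, M0, hM⟩ := hf.exists_bound (hc 0)
  refine ⟨M, M0, fun x => ?_⟩
  by_cases hx : f x ≤ 0
  · exact (abs_le.1 (hM x hx)).1
  · linarith

lemma CompactSublevels.measurable [T2Space X] [MeasurableSpace X] [BorelSpace X] {f : X → ℝ}
    (hc : CompactSublevels f) : Measurable f :=
  measurable_of_Iic fun r => (hc r).isClosed.measurableSet

variable [MeasurableSpace X] [MeasurableSpace Y] [T2Space X] [T2Space Y]
  [BorelSpace X] [BorelSpace Y] {lam : Measure X} {nu : Measure Y}
  {U : X → ℝ} {V : Y → ℝ} {W : X → Y → ℝ} {δ : ℝ}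

/-- Square integrability is e^{-U} e^{2δU} = e^{-(1-2δ)U}. For the drift, condition (A) gives
e^{W^V} ≤ θ e^{δU}. The set {1/θ ≤ 1/ε} is compact, so `U` is bounded there, and `θ` is below `ε`
off it. For the minorization, `W` is bounded on a product of two compact sub-level sets. -/
lemma halfSys_of_lyapunov (hη : IsProbabilityMeasure (gibbs nu V))
    (hU : LocallyBounded U) (hW : LocallyBounded (Function.uncurry W))
    (hUc : CompactSublevels U) (hVc : CompactSublevels V) (δ0 : 0 < δ)
    (hi : ∫⁻ x, ENNReal.ofReal (Real.exp (-((1 - 2 * δ) * U x))) ∂lam < ∞)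
    (hWi : ∀ x, Integrable (fun y => W x y) (gibbs nu V))
    {θ : X → ℝ} (hθ : MemBZero θ)
    (hle : ∀ x, Real.exp (-(δ * U x - ∫ y, W x y ∂(gibbs nu V))) ≤ θ x) :
    HalfSys (gibbs lam U) (gibbs nu V) W (fun x => Real.exp (δ * U x)) := by
  have mU := hUc.measurable
  refine ⟨(mU.const_mul δ).exp, ?_, ?_, hWi, ?_, ?_⟩
  · obtain ⟨M, _, hM⟩ := hU.exists_lower_bound hUc
    exact ⟨Real.exp (δ * -M), Real.exp_pos _, fun x =>
      Real.exp_le_exp.2 (mul_le_mul_of_nonneg_left (hM x) δ0.le)⟩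
  · unfold gibbs
    rw [integrable_withDensity_ofReal (measurable_exp_neg mU) fun _ => (Real.exp_pos _).le]
    have e : (fun x => Real.exp (-U x) * Real.exp (δ * U x) ^ 2)
        = fun x => Real.exp (-((1 - 2 * δ) * U x)) := by
      funext x
      rw [sq, ← Real.exp_add, ← Real.exp_add]; ring_nf
    rw [e]
    refine ⟨(mU.const_mul _).neg.exp.aestronglyMeasurable, ?_⟩
    rwa [hasFiniteIntegral_iff_ofReal (ae_of_all _ fun _ => (Real.exp_pos _).le)]
  · intro ε ε0
    obtain ⟨ε', ε'0, hε'⟩ := hθ.2.uniformly_pos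
    obtain ⟨M, _, hM⟩ := hU.exists_bound (hθ.2.compact_sublevels (1 / ε))
    refine ⟨1 / ε' * Real.exp (δ * M), fun x => ?_⟩
    have h1 : Real.exp (∫ y, W x y ∂(gibbs nu V)) ≤ θ x * Real.exp (δ * U x) := by
      calc _ = Real.exp (-(δ * U x - ∫ y, W x y ∂(gibbs nu V))) * Real.exp (δ * U x) := by
            rw [← Real.exp_add]; ring_nf
        _ ≤ _ := mul_le_mul_of_nonneg_right (hle x) (Real.exp_pos _).le
    refine h1.trans ?_
    have θ0 := hθ.1 x
    have e0 := Real.exp_pos (δ * U x)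
    by_cases hx : 1 / θ x ≤ 1 / ε
    · have h2 : θ x ≤ 1 / ε' := by
        rw [le_one_div θ0 ε'0]; exact hε' x
      have h3 : Real.exp (δ * U x) ≤ Real.exp (δ * M) :=
        Real.exp_le_exp.2 (mul_le_mul_of_nonneg_left ((le_abs_self _).trans (hM x hx)) δ0.le)
      have := mul_le_mul h2 h3 e0.le (by positivity)
      nlinarith [mul_pos ε0 e0]
    · have h2 : θ x ≤ ε := by
        rw [not_le, one_div_lt_one_div ε0 θ0] at hx
        exact hx.le
      have h3 : 0 ≤ 1 / ε' * Real.exp (δ * M) := by positivity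
      nlinarith [mul_le_mul_of_nonneg_right h2 e0.le]
  · intro r
    -- The sub-level sets exhaust `Y`, which has mass one.
    have hn : ∃ n : ℕ, 0 < gibbs nu V {y | V y ≤ n} := by
      by_contra hcon
      push Not at hcon
      have hu : (⋃ n : ℕ, {y | V y ≤ n}) = Set.univ := by
        refine Set.eq_univ_of_forall fun y => Set.mem_iUnion.2 ?_
        exact exists_nat_ge (V y)
      have h0 : gibbs nu V Set.univ = 0 := by
        rw [← hu]
        exact measure_iUnion_null fun n => le_antisymm (hcon n) zero_le
      rw [measure_univ] at h0
      exact one_ne_zero h0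
    obtain ⟨n, hn⟩ := hn
    refine ⟨_, (hVc n).isClosed.measurableSet, hn, ?_⟩
    -- The maximum with 1 keeps the argument of the logarithm positive for every real `r`.
    obtain ⟨M, _, hM⟩ := hW.exists_bound ((hUc (Real.log (max r 1) / δ)).prod (hVc n))
    refine ⟨M, fun x hx y hy => (le_abs_self _).trans (hM (x, y) ⟨?_, hy⟩)⟩
    have h1 : δ * U x ≤ Real.log (max r 1) :=
      (Real.le_log_iff_exp_le (lt_max_of_lt_right one_pos)).2 (hx.trans (le_max_left _ _))
    exact (le_div_iff₀' δ0).2 h1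

end Topological

/-! ### Sinkhorn potentials and transitions -/

section ModelSection

variable {X Y : Type*} [MeasurableSpace X] [MeasurableSpace Y]

/-- The Sinkhorn model, expressed by a normalized system of Gibbs measures. -/
structure Model (lam : Measure X) (nu : Measure Y) (U : X → ℝ) (V : Y → ℝ) (W : X → Y → ℝ)
    (g : X → ℝ) (h : Y → ℝ) (k : ℝ) : Prop where
  sys : Sys (gibbs lam U) (gibbs nu V) W g h k
  measU : Measurable U
  measV : Measurable V
  norm : ∀ x, ∫⁻ y, ENNReal.ofReal (Real.exp (-W x y)) ∂nu = 1
  abs_le : ∃ C : ℝ, ∀ y, |V y| ≤ C * h y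

variable {lam : Measure X} {nu : Measure Y} {U : X → ℝ} {V : Y → ℝ} {W : X → Y → ℝ}
  {g : X → ℝ} {h : Y → ℝ} {k : ℝ}

lemma pot_even (n : ℕ) : pot lam nu U V W (2 * n + 1) = (potU lam nu U V W (2 * n), fun y =>
    V y + Real.log (op (flat W) lam (fun x => Real.exp (-potU lam nu U V W (2 * n) x)) y)) := by
  rw [pot]
  simp only [even_two_mul, if_true]
  rfl

lemma pot_odd (n : ℕ) : pot lam nu U V W (2 * (n + 1)) = (fun x =>
    U x + Real.log (op W nu (fun y => Real.exp (-potV lam nu U V W (2 * n + 1) y)) x),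
    potV lam nu U V W (2 * n + 1)) := by
  rw [show 2 * (n + 1) = 2 * n + 1 + 1 by ring, pot]
  have : ¬ Even (2 * n + 1) := by simp
  simp only [this, if_false]
  rfl

lemma potU_odd (n : ℕ) : potU lam nu U V W (2 * n + 1) = potU lam nu U V W (2 * n) := by
  unfold potU; rw [pot_even]; rfl

lemma potV_odd (n : ℕ) (y : Y) : potV lam nu U V W (2 * n + 1) y = V y +
    Real.log (op (flat W) lam (fun x => Real.exp (-potU lam nu U V W (2 * n) x)) y) := by
  rw [potV, pot_even]

lemma potU_even (n : ℕ) (x : X) : potU lam nu U V W (2 * (n + 1)) x = U x +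
    Real.log (op W nu (fun y => Real.exp (-potV lam nu U V W (2 * n + 1) y)) x) := by
  rw [potU, pot_odd]

lemma potV_even (n : ℕ) : potV lam nu U V W (2 * (n + 1)) = potV lam nu U V W (2 * n + 1) := by
  rw [potV, pot_odd]

lemma op_eq_integral_gibbs {A : Type*} {W : A → Y → ℝ} (hV : Measurable V) (v : Y → ℝ) (x : A) :
    op W nu (fun y => Real.exp (-v y)) x
      = ∫ y, Real.exp (-W x y - (v y - V y)) ∂(gibbs nu V) := by
  unfold gibbs op
  rw [integral_withDensity_ofReal (measurable_exp_neg hV) fun _ => (Real.exp_pos _).le]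
  refine integral_congr_ae (ae_of_all _ fun y => ?_)
  simp only [← Real.exp_add]
  ring_nf

lemma logOp_of_lowerPot {μ : Measure X} (S : Sys μ (gibbs nu V) W g h k) (hV : Measurable V)
    {v : Y → ℝ} (hv : LowerPot μ (flat W) k fun y => v y - V y) :
    LogOp nu W v (lse W (gibbs nu V) fun y => v y - V y) where
  meas_right := by
    have : Measurable fun y => v y - V y + V y := hv.meas.add hV
    simpa using this
  meas_left := S.measurable_lse hv.meas
  integrable := fun x => by
    have := S.integrable_ker hv x
    unfold gibbs at this
    rw [integrable_withDensity_ofReal (measurable_exp_neg hV) fun _ => (Real.exp_pos _).le] at this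
    refine this.congr (ae_of_all _ fun y => ?_)
    simp only [← Real.exp_add]
    ring_nf
  exp_eq := fun x => by rw [S.exp_lse hv, op_eq_integral_gibbs hV]

/-- The index on `Y` is odd because V_0 = 0 is not produced by the iteration: the first potential it
yields is V_1 = V_2. -/
lemma iter_pot (M : Model lam nu U V W g h k) :
    Iter (gibbs lam U) (gibbs nu V) W (fun n x => potU lam nu U V W (2 * n) x - U x)
      (fun n y => potV lam nu U V W (2 * n + 1) y - V y) where
  zero := by funext x; simp [potU, pot]
  right := fun n => by
    funext y
    rw [potV_odd, add_sub_cancel_left, op_eq_integral_gibbs M.measU]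
    rfl
  left := fun n => by
    funext x
    rw [potU_even, add_sub_cancel_left, op_eq_integral_gibbs M.measV]
    rfl

lemma Model.exists_adm (M : Model lam nu U V W g h k) : ∃ K : ℝ, 0 ≤ K ∧ ∀ n,
    Adm (gibbs lam U) (gibbs nu V) W k K (fun x => potU lam nu U V W (2 * n) x - U x) ∧
    Adm (gibbs nu V) (gibbs lam U) (flat W) k K
      (fun y => potV lam nu U V W (2 * n + 1) y - V y) :=
  M.sys.exists_adm (iter_pot M)

lemma Model.measurable_potU (M : Model lam nu U V W g h k) (n : ℕ) :
    Measurable (potU lam nu U V W (2 * n)) := by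
  obtain ⟨K, _, hK⟩ := M.exists_adm
  have : Measurable fun x => potU lam nu U V W (2 * n) x - U x + U x := (hK n).1.meas.add M.measU
  simpa using this

lemma Model.logOp_odd (M : Model lam nu U V W g h k) (n : ℕ) :
    LogOp lam (flat W) (potU lam nu U V W (2 * n))
      (fun y => potV lam nu U V W (2 * (n + 1)) y - V y) := by
  obtain ⟨K, _, hK⟩ := M.exists_adm
  have := logOp_of_lowerPot M.sys.symm M.measU (hK n).1.toLowerPot
  rw [potV_even]
  convert! this using 1
  exact (iter_pot M).right n

lemma Model.logOp_even (M : Model lam nu U V W g h k) (n : ℕ) :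
    LogOp nu W (potV lam nu U V W (2 * n)) (fun x => potU lam nu U V W (2 * n) x - U x) := by
  cases n with
  | zero =>
    -- For n = 0 the normalization is the Markov property of the reference transition; later it is
    -- the iteration itself.
    have e : potV lam nu U V W (2 * 0) = fun _ => 0 := rfl
    have e' : (fun x => potU lam nu U V W (2 * 0) x - U x) = fun _ => 0 := (iter_pot M).zero
    rw [e, e']
    have m : ∀ x, Measurable fun y => Real.exp (-W x y) := fun x => (M.sys.meas_section x).neg.exp
    refine ⟨measurable_const, measurable_const, fun x => ?_, fun x => ?_⟩
    · simp only [neg_zero, Real.exp_zero, mul_one]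
      refine ⟨(m x).aestronglyMeasurable, ?_⟩
      rw [hasFiniteIntegral_iff_ofReal (ae_of_all _ fun _ => (Real.exp_pos _).le), M.norm]
      exact ENNReal.one_lt_top
    · simp only [op, neg_zero, Real.exp_zero, mul_one]
      rw [integral_eq_lintegral_of_nonneg_ae (ae_of_all _ fun _ => (Real.exp_pos _).le)
        (m x).aestronglyMeasurable, M.norm, ENNReal.toReal_one]
  | succ n =>
    obtain ⟨K, _, hK⟩ := M.exists_adm
    have := logOp_of_lowerPot M.sys M.measV (hK n).2.toLowerPot
    rw [potV_even]
    convert! this using 1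
    exact (iter_pot M).left n

lemma Model.measurable_potV (M : Model lam nu U V W g h k) (n : ℕ) :
    Measurable (potV lam nu U V W (2 * n)) := (M.logOp_even n).meas_right

/-- The log-ratios are differences of successive potentials, so the series defining the limits
telescope. -/
lemma Model.ratioX_eq (M : Model lam nu U V W g h k) (n : ℕ) (x : X) :
    ratioX lam nu U V W n x = Real.exp (potU lam nu U V W (2 * n) x
      - potU lam nu U V W (2 * (n + 1)) x) := by
  unfold ratioX
  rw [potU_odd, ← potV_even, ← (M.logOp_even (n + 1)).exp_eq, ← Real.exp_add, ← Real.exp_sub]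
  ring_nf

lemma Model.ratioY_eq (M : Model lam nu U V W g h k) (n : ℕ) (y : Y) :
    ratioY lam nu U V W n y = Real.exp (potV lam nu U V W (2 * n) y
      - potV lam nu U V W (2 * (n + 1)) y) := by
  unfold ratioY
  rw [← (M.logOp_odd n).exp_eq, ← Real.exp_add, ← Real.exp_sub]
  ring_nf

lemma Model.isMarkovKernel_transEven [SFinite nu] (M : Model lam nu U V W g h k) (n : ℕ) :
    IsMarkovKernel (transEven lam nu U V W n) :=
  isMarkovKernel_tilted M.sys.meas_cost (M.logOp_even n)

lemma Model.isMarkovKernel_transOdd [SFinite lam] (M : Model lam nu U V W g h k) (n : ℕ) :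
    IsMarkovKernel (transOdd lam nu U V W n) := by
  unfold transOdd
  rw [potU_odd]
  exact isMarkovKernel_tilted M.sys.symm.meas_cost (M.logOp_odd n)

variable [SFinite lam] [SFinite nu]

lemma Model.bridgeEven_eq (M : Model lam nu U V W g h k) (n : ℕ) :
    bridgeEven lam nu U V W n
      = joint lam nu W (potU lam nu U V W (2 * n)) (potV lam nu U V W (2 * n)) := by
  unfold bridgeEven transEven
  rw [compProd_tilted M.sys.meas_cost (M.logOp_even n) M.measU]
  simp

lemma Model.compProd_transOdd (M : Model lam nu U V W g h k) (n : ℕ) :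
    (gibbs nu V).compProd (transOdd lam nu U V W n)
      = joint nu lam (flat W) (potV lam nu U V W (2 * (n + 1))) (potU lam nu U V W (2 * n)) := by
  unfold transOdd
  rw [potU_odd, compProd_tilted M.sys.symm.meas_cost (M.logOp_odd n) M.measV]
  simp

lemma Model.bridgeOdd_eq (M : Model lam nu U V W g h k) (n : ℕ) :
    bridgeOdd lam nu U V W n
      = joint lam nu W (potU lam nu U V W (2 * n)) (potV lam nu U V W (2 * (n + 1))) := by
  unfold bridgeOdd
  rw [M.compProd_transOdd, joint_map_swap M.sys.meas_cost (M.measurable_potU n)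
    (M.measurable_potV (n + 1))]

lemma Model.piEven_eq (M : Model lam nu U V W g h k) (n : ℕ) :
    piEven lam nu U V W n = gibbs nu (fun y => potV lam nu U V W (2 * n) y
      - (potV lam nu U V W (2 * (n + 1)) y - V y)) := by
  have := sFinite_gibbs (lam := lam) U
  have := M.isMarkovKernel_transEven n
  rw [piEven, ← Measure.snd_compProd, ← bridgeEven, M.bridgeEven_eq,
    joint_snd M.sys.meas_cost (M.logOp_odd n) (M.measurable_potV n)]

lemma Model.piOdd_eq (M : Model lam nu U V W g h k) (n : ℕ) :
    piOdd lam nu U V W n = gibbs lam (fun x => potU lam nu U V W (2 * n) x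
      - (potU lam nu U V W (2 * (n + 1)) x - U x)) := by
  have := sFinite_gibbs (lam := nu) V
  have := M.isMarkovKernel_transOdd n
  rw [piOdd, ← Measure.snd_compProd, M.compProd_transOdd]
  exact joint_snd (W := flat W) M.sys.symm.meas_cost (M.logOp_even (n + 1)) (M.measurable_potU n)

lemma Model.piEven_compProd (M : Model lam nu U V W g h k) (n : ℕ) :
    ((piEven lam nu U V W n).compProd (transOdd lam nu U V W n)).map Prod.swap
      = bridgeEven lam nu U V W n := by
  rw [M.piEven_eq, M.bridgeEven_eq, transOdd, potU_odd,
    compProd_tilted M.sys.symm.meas_cost (M.logOp_odd n)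
      (measurable_fun_sub (M.measurable_potV n) (M.logOp_odd n).meas_left)]
  simp only [sub_add_cancel]
  exact joint_map_swap M.sys.meas_cost (M.measurable_potU n) (M.measurable_potV n)

lemma Model.piOdd_compProd (M : Model lam nu U V W g h k) (n : ℕ) :
    (piOdd lam nu U V W n).compProd (transEven lam nu U V W (n + 1))
      = bridgeOdd lam nu U V W n := by
  rw [M.piOdd_eq, M.bridgeOdd_eq, transEven,
    compProd_tilted M.sys.meas_cost (M.logOp_even (n + 1))
      (measurable_fun_sub (M.measurable_potU n) (M.logOp_even (n + 1)).meas_left)]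
  simp only [sub_add_cancel]

lemma Model.bayesRecursion (M : Model lam nu U V W g h k) : BayesRecursion lam nu U V W := by
  refine ⟨?_, fun n => ⟨M.isMarkovKernel_transEven n, M.isMarkovKernel_transOdd n,
    M.piEven_compProd n, M.piOdd_compProd n⟩⟩
  unfold bridgeEven transEven
  congr 1
  have e : op W nu (fun z => Real.exp (-potV lam nu U V W (2 * 0) z)) = fun _ => 1 := by
    funext x
    rw [← (M.logOp_even 0).exp_eq]
    simp [potU, pot]
  unfold tilted refKernel
  rw [e]
  simp [potV, pot]

lemma Model.gibbs_eq_piEven_withDensity (M : Model lam nu U V W g h k) (n : ℕ) :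
    gibbs nu V = (piEven lam nu U V W n).withDensity
      (fun y => ENNReal.ofReal (ratioY lam nu U V W n y)) := by
  simp_rw [M.ratioY_eq]
  rw [M.piEven_eq, gibbs_withDensity (measurable_fun_sub (M.measurable_potV n) (M.logOp_odd n).meas_left)
    (measurable_fun_sub (M.measurable_potV n) (M.measurable_potV (n + 1)))]
  congr 1; funext y; ring

lemma Model.gibbs_eq_piOdd_withDensity (M : Model lam nu U V W g h k) (n : ℕ) :
    gibbs lam U = (piOdd lam nu U V W n).withDensity
      (fun x => ENNReal.ofReal (ratioX lam nu U V W n x)) := by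
  simp_rw [M.ratioX_eq]
  rw [M.piOdd_eq, gibbs_withDensity
    (measurable_fun_sub (M.measurable_potU n) (M.logOp_even (n + 1)).meas_left)
    (measurable_fun_sub (M.measurable_potU n) (M.measurable_potU (n + 1)))]
  congr 1; funext x; ring

lemma Model.piEven_withDensity (M : Model lam nu U V W g h k) (n : ℕ) :
    piEven lam nu U V W n = (gibbs nu V).withDensity fun y => ENNReal.ofReal
      (Real.exp (potV lam nu U V W (2 * (n + 1)) y - potV lam nu U V W (2 * n) y)) := by
  rw [M.piEven_eq, gibbs_withDensity M.measV
    (measurable_fun_sub (M.measurable_potV (n + 1)) (M.measurable_potV n))]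
  congr 1; funext y; ring

lemma Model.piOdd_withDensity (M : Model lam nu U V W g h k) (n : ℕ) :
    piOdd lam nu U V W n = (gibbs lam U).withDensity fun x => ENNReal.ofReal
      (Real.exp (potU lam nu U V W (2 * (n + 1)) x - potU lam nu U V W (2 * n) x)) := by
  rw [M.piOdd_eq, gibbs_withDensity M.measU
    (measurable_fun_sub (M.measurable_potU (n + 1)) (M.measurable_potU n))]
  congr 1; funext x; ring

/-- Bayes' rule: the second marginal of π_{2n+1} × 𝒦_{2n+2} is that of the preceding bridge, which
is η. As μ is sent to π_{2n+2} by the same kernel, the contraction compares the two pairs. -/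
lemma Model.piOdd_bind (M : Model lam nu U V W g h k) (n : ℕ) :
    (piOdd lam nu U V W n).bind (transEven lam nu U V W (n + 1)) = gibbs nu V := by
  have := M.isMarkovKernel_transEven (n + 1)
  have := M.isMarkovKernel_transOdd n
  have := sFinite_gibbs (lam := nu) V
  have : SFinite (piOdd lam nu U V W n) := by rw [M.piOdd_eq]; exact sFinite_gibbs _
  rw [← Measure.snd_compProd, M.piOdd_compProd, bridgeOdd, Measure.snd_map_swap,
    Measure.fst_compProd]

lemma Model.piEven_bind (M : Model lam nu U V W g h k) (n : ℕ) :
    (piEven lam nu U V W n).bind (transOdd lam nu U V W n) = gibbs lam U := by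
  have := M.isMarkovKernel_transEven n
  have := M.isMarkovKernel_transOdd n
  have := sFinite_gibbs (lam := lam) U
  have : SFinite (piEven lam nu U V W n) := by rw [M.piEven_eq]; exact sFinite_gibbs _
  rw [← Measure.snd_compProd, ← Measure.fst_map_swap, M.piEven_compProd, bridgeEven,
    Measure.fst_compProd]

end ModelSection

/-! ### Geometric decay of the log-ratios -/

lemma memProb_of_integrable {Z : Type*} [MeasurableSpace Z] {w : Z → ℝ} {m : Measure Z}
    (hm : IsProbabilityMeasure m) (hi : Integrable w m) : MemProb w m :=
  ⟨hm, hi.lintegral_lt_top⟩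

lemma wtv_comm {Z : Type*} [MeasurableSpace Z] (w : Z → ℝ) (m₁ m₂ : Measure Z) :
    wtv w m₁ m₂ = wtv w m₂ m₁ := by
  unfold wtv; rw [add_comm]

lemma wnorm_le {Z : Type*} {g f : Z → ℝ} (g0 : ∀ z, 0 < g z) {c : ℝ}
    (hf : ∀ z, |f z| ≤ c * g z) : wnorm g f ≤ ENNReal.ofReal c :=
  iSup_le fun z => ENNReal.ofReal_le_ofReal ((div_le_iff₀ (g0 z)).2 (hf z))

lemma geometric_limit {a : ℕ → ℝ} {C r : ℝ} (r0 : 0 ≤ r) (r1 : r < 1)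
    (h : ∀ n, |a (n + 1) - a n| ≤ C * r ^ n) :
    Filter.Tendsto a Filter.atTop (𝓝 (a 0 - ∑' l, (a l - a (l + 1)))) ∧
    ∀ n, |(a 0 - ∑' l, (a l - a (l + 1))) - a n| ≤ C * r ^ n / (1 - r) := by
  have hs : Summable fun l => a l - a (l + 1) := by
    refine Summable.of_norm_bounded ((summable_geometric_of_lt_one r0 r1).mul_left C) fun n => ?_
    rw [Real.norm_eq_abs, abs_sub_comm]
    exact h n
  have ht : Filter.Tendsto a Filter.atTop (𝓝 (a 0 - ∑' l, (a l - a (l + 1)))) := by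
    have h1 := hs.hasSum.tendsto_sum_nat.const_sub (a 0)
    refine h1.congr fun n => ?_
    rw [Finset.sum_range_sub']
    ring
  refine ⟨ht, fun n => ?_⟩
  have := dist_le_of_le_geometric_of_tendsto r C r1 (fun n => by
    rw [Real.dist_eq, abs_sub_comm]; exact h n) ht n
  rwa [Real.dist_eq, abs_sub_comm] at this

section Decay

variable {X Y : Type*} [MeasurableSpace X] [MeasurableSpace Y]

namespace Sys

variable {μ : Measure X} {η : Measure Y} {W : X → Y → ℝ} {g : X → ℝ} {h : Y → ℝ} {k K : ℝ}

/-- Turns the distance of a Sinkhorn marginal from its target into a real integral. The last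
inequality passes to the weight `g` used by the stability estimate. -/
lemma wtv_density (S : Sys μ η W g h k) {φ φ' : X → ℝ} (hφ : LowerPot η W k φ)
    (hφ' : Measurable φ') (hK : ∀ x, φ' x ≤ K) {m : Measure X} (hm : IsProbabilityMeasure m)
    (hd : m = μ.withDensity fun x => ENNReal.ofReal (Real.exp (φ' x - φ x))) {a : ℝ}
    (a0 : 0 < a) :
    MemProb (fun x => 1 / 2 + a * g x) m ∧ MemProb (fun x => 1 / 2 + a * g x) μ ∧
    wtv (fun x => 1 / 2 + a * g x) m μ
      = ENNReal.ofReal (∫ x, (1 / 2 + a * g x) * |Real.exp (φ' x - φ x) - 1| ∂μ) ∧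
    a * ∫ x, g x * |Real.exp (φ' x - φ x) - 1| ∂μ
      ≤ ∫ x, (1 / 2 + a * g x) * |Real.exp (φ' x - φ x) - 1| ∂μ := by
  have := S.prob_left
  have mr : Measurable fun x => Real.exp (φ' x - φ x) := (hφ'.sub hφ.meas).exp
  have r0 : ∀ x, 0 ≤ Real.exp (φ' x - φ x) := fun x => (Real.exp_pos _).le
  have ig : Integrable (fun x => Real.exp (φ' x - φ x) * g x) μ := by
    refine ((S.integrable_weight_mul_exp_neg hφ).const_mul (Real.exp K)).mono'
      (mr.mul S.left.meas_weight).aestronglyMeasurable (ae_of_all _ fun x => ?_)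
    have g0 := S.weight_pos' x
    rw [Real.norm_eq_abs, abs_of_pos (by positivity)]
    calc _ ≤ Real.exp K * Real.exp (-φ x) * g x := by
          rw [← Real.exp_add]
          gcongr
          linarith [hK x]
      _ = _ := by ring
  have igm : Integrable g m := by
    rw [hd, integrable_withDensity_ofReal mr r0]; exact ig
  have mw : Measurable fun x => 1 / 2 + a * g x := (S.left.meas_weight.const_mul a).const_add _
  have i1 := S.symm.integrable_weight_mul_abs_exp_sub hφ hφ' hK
  have i2 : Integrable (fun x => |Real.exp (φ' x - φ x) - 1|) μ := by
    have : Integrable (fun x => Real.exp (φ' x - φ x)) μ := by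
      have h1 : Integrable (fun _ => (1 : ℝ)) m := integrable_const 1
      rw [hd, integrable_withDensity_ofReal mr r0] at h1
      simpa using h1
    exact (this.sub (integrable_const 1)).abs
  have i3 : Integrable (fun x => (1 / 2 + a * g x) * |Real.exp (φ' x - φ x) - 1|) μ := by
    refine ((i2.const_mul (1 / 2)).add (i1.const_mul a)).congr (ae_of_all _ fun x => ?_)
    simp only [Pi.add_apply]; ring
  refine ⟨memProb_of_integrable hm ((integrable_const _).add (igm.const_mul a)),
    memProb_of_integrable S.prob_left
      ((integrable_const _).add (S.integrable_weight.const_mul a)), ?_, ?_⟩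
  · have e1 : μ = μ.withDensity fun x => ENNReal.ofReal ((fun _ => (1 : ℝ)) x) := by simp
    have f1 : IsFiniteMeasure (μ.withDensity fun x => ENNReal.ofReal ((fun _ => (1 : ℝ)) x)) := by
      rw [← e1]; infer_instance
    have f2 : IsFiniteMeasure
        (μ.withDensity fun x => ENNReal.ofReal (Real.exp (φ' x - φ x))) := by
      rw [← hd]; infer_instance
    conv_lhs => rw [hd]
    have := wtv_withDensity (M := μ) mw mr measurable_const r0 (fun _ => zero_le_one)
    rw [← e1] at this
    rw [this, ofReal_integral_eq_lintegral_ofReal i3]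
    refine ae_of_all _ fun x => ?_
    have g0 := S.weight_pos' x
    simp only [Pi.zero_apply]
    positivity
  · rw [← integral_const_mul]
    refine integral_mono (i1.const_mul a) i3 fun x => ?_
    have := abs_nonneg (Real.exp (φ' x - φ x) - 1)
    simp only
    nlinarith

lemma exists_abs_le (S : Sys μ η W g h k) (K : ℝ) : ∃ C : ℝ, 0 < C ∧
    ∀ φ, LowerPot η W k φ → (∀ x, φ x ≤ K) → ∀ x, |φ x| ≤ C * g x := by
  obtain ⟨C, C0, hC⟩ := S.exists_exp_mean_le
  obtain ⟨C', C'0, hC'⟩ := S.exists_affine_le (k + |K|)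
  refine ⟨C + C', by positivity, fun φ hφ hK x => ?_⟩
  have h1 := hφ.lower x
  have h2 := hK x
  have h3 := hC x
  have h4 := hC' x
  have h5 := Real.add_one_le_exp (∫ y, W x y ∂η)
  have h6 := S.weight_pos' x
  have h7 := le_abs_self K
  have h8 := abs_nonneg K
  have h9 := S.bound_nonneg
  have h10 := mul_pos C0 h6
  rw [add_mul]
  exact abs_le.2 ⟨by linarith, by linarith⟩

/-- The common lower bound passes to the limit and also supplies the dominating function. -/
lemma tendsto_lse (S : Sys μ η W g h k) {ψ : ℕ → Y → ℝ} {ψ' : Y → ℝ}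
    (hψ : ∀ n, LowerPot μ (flat W) k (ψ n))
    (ht : ∀ y, Filter.Tendsto (fun n => ψ n y) Filter.atTop (𝓝 (ψ' y))) :
    LowerPot μ (flat W) k ψ' ∧
    ∀ x, Filter.Tendsto (fun n => lse W η (ψ n) x) Filter.atTop (𝓝 (lse W η ψ' x)) := by
  have hl : LowerPot μ (flat W) k ψ' :=
    ⟨measurable_of_tendsto_metrizable (fun n => (hψ n).meas) (tendsto_pi_nhds.2 ht),
      fun y => ge_of_tendsto' (ht y) fun n => (hψ n).lower y⟩
  refine ⟨hl, fun x => ?_⟩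
  refine Filter.Tendsto.log ?_ (S.integral_ker_pos hl x).ne'
  refine tendsto_integral_of_dominated_convergence
    (fun y => Real.exp k * (Real.exp k * Real.exp (∫ x, W x y ∂μ)))
    (fun n => (S.integrable_ker (hψ n) x).aestronglyMeasurable)
    ((S.symm.integrable_exp_mean.const_mul _).const_mul _)
    (fun n => ae_of_all _ fun y => ?_) (ae_of_all _ fun y => ?_)
  · rw [Real.norm_eq_abs, Real.abs_exp]
    exact (S.exp_cost_le x y _).trans
      (mul_le_mul_of_nonneg_left (S.symm.exp_neg_le (hψ n) y) (Real.exp_pos _).le)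
  · exact (Real.continuous_exp.tendsto _).comp ((ht y).const_sub _)

end Sys

lemma isGibbs_tilted {nu : Measure Y} [SFinite nu] {V : Y → ℝ} {W : X → Y → ℝ}
    (hW : Measurable (Function.uncurry W)) (hV : Measurable V) {v : Y → ℝ} {w : X → ℝ}
    (H : LogOp nu W v w) :
    Sys.IsGibbs (tilted W nu v) (gibbs nu V) W w (fun y => v y - V y) := by
  intro x
  have m : Measurable fun y => -W x y - w x - (v y - V y) :=
    ((hW.comp measurable_prodMk_left).neg.sub_const _).sub (H.meas_right.sub hV)
  rw [tilted_apply hW H, gibbs_withDensity hV m, gibbs]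
  congr 1; funext y
  ring_nf

end Decay

/-! ### Convergence of the potentials, the Schrödinger system and the bridge -/

section Convergence

variable {X Y : Type*} [MeasurableSpace X] [MeasurableSpace Y]
  {lam : Measure X} {nu : Measure Y} {U : X → ℝ} {V : Y → ℝ} {W : X → Y → ℝ}
  {g : X → ℝ} {h : Y → ℝ} {k : ℝ}

section Kernels

variable [SFinite lam] [SFinite nu]

/-- Uniform contraction of the Sinkhorn transitions for general weights. -/
def ContractsWith (lam : Measure X) (nu : Measure Y) [SFinite lam] [SFinite nu] (U : X → ℝ)
    (V : Y → ℝ) (W : X → Y → ℝ) (g : X → ℝ) (h : Y → ℝ) (a ϱ : ℝ) : Prop :=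
  ∀ n : ℕ, 1 ≤ n →
    lip (fun x => 1 / 2 + a * g x) (fun y => 1 / 2 + a * h y)
      (transEven lam nu U V W n) ≤ ENNReal.ofReal ϱ ∧
    lip (fun y => 1 / 2 + a * h y) (fun x => 1 / 2 + a * g x)
      (transOdd lam nu U V W n) ≤ ENNReal.ofReal ϱ

lemma Model.exists_contractsWith (M : Model lam nu U V W g h k) :
    ∃ a ϱ : ℝ, 0 < a ∧ 0 < ϱ ∧ ϱ < 1 ∧ ContractsWith lam nu U V W g h a ϱ := by
  obtain ⟨K, K0, hK⟩ := M.exists_adm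
  obtain ⟨a₁, a₁0, h₁⟩ := M.sys.exists_contraction K
  obtain ⟨a₂, a₂0, h₂⟩ := M.sys.symm.exists_contraction K
  have a0 : 0 < min a₁ a₂ := lt_min a₁0 a₂0
  obtain ⟨ρ₁, ρ₁1, h₁⟩ := h₁ _ a0 (min_le_left _ _)
  obtain ⟨ρ₂, ρ₂1, h₂⟩ := h₂ _ a0 (min_le_right _ _)
  refine ⟨min a₁ a₂, max (1 / 2) (max ρ₁ ρ₂), a0, lt_max_of_lt_left (by norm_num),
    max_lt (by norm_num) (max_lt ρ₁1 ρ₂1), fun n hn => ?_⟩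
  -- V_{2n+2} = V_{2n+1} comes from the iteration and is admissible; V_0 = 0 does not, so 𝒦_0 is
  -- left out.
  obtain ⟨n, rfl⟩ : ∃ m, n = m + 1 := ⟨n - 1, by omega⟩
  have L := (hK n).2
  rw [← potV_even] at L
  have L' := (hK (n + 1)).2
  rw [← potV_even] at L'
  constructor
  · exact h₁ _ ((le_max_left _ _).trans (le_max_right _ _)) _ _ _
      (M.isMarkovKernel_transEven (n + 1)) (hK (n + 1)).1.toLowerPot L.toLowerPot
      (hK (n + 1)).1.upper L.upper
      (isGibbs_tilted M.sys.meas_cost M.measV (M.logOp_even (n + 1)))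
  · refine h₂ _ ((le_max_right _ _).trans (le_max_right _ _)) _ _ _
      (M.isMarkovKernel_transOdd (n + 1)) L'.toLowerPot (hK (n + 1)).1.toLowerPot
      L'.upper (hK (n + 1)).1.upper ?_
    unfold transOdd
    rw [potU_odd]
    exact isGibbs_tilted M.sys.symm.meas_cost M.measU (M.logOp_odd (n + 1))

/-- Under uniform contraction the increments of the potentials decay geometrically. -/
lemma Model.exists_decay (M : Model lam nu U V W g h k) {a ϱ : ℝ} (a0 : 0 < a) (ϱ0 : 0 < ϱ)
    (hc : ContractsWith lam nu U V W g h a ϱ) : ∃ C : ℝ, 0 < C ∧ ∀ n : ℕ,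
    (∀ x, |potU lam nu U V W (2 * (n + 1)) x - potU lam nu U V W (2 * n) x|
      ≤ C * g x * (ϱ ^ 2) ^ n) ∧
    (∀ y, |potV lam nu U V W (2 * (n + 1)) y - potV lam nu U V W (2 * n) y|
      ≤ C * h y * (ϱ ^ 2) ^ n) := by
  have hμ := M.sys.prob_left
  have hη := M.sys.prob_right
  obtain ⟨K, K0, hK⟩ := M.exists_adm
  have I := iter_pot M
  set φ : ℕ → X → ℝ := fun n x => potU lam nu U V W (2 * n) x - U x with hφ
  set ψ : ℕ → Y → ℝ := fun n y => potV lam nu U V W (2 * n + 1) y - V y with hψ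
  -- `D n` is the weighted distance between π_{2n+1} and μ, and `E n` the one between π_{2n+2} and
  -- η.
  set D : ℕ → ℝ := fun n => ∫ x, (1 / 2 + a * g x) * |Real.exp (φ (n + 1) x - φ n x) - 1|
    ∂(gibbs lam U) with hD
  set E : ℕ → ℝ := fun n => ∫ y, (1 / 2 + a * h y) * |Real.exp (ψ (n + 1) y - ψ n y) - 1|
    ∂(gibbs nu V) with hE
  have eφ : ∀ n x, potU lam nu U V W (2 * (n + 1)) x - potU lam nu U V W (2 * n) x
      = φ (n + 1) x - φ n x := fun n x => by simp only [hφ]; ring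
  have eψ : ∀ n y, potV lam nu U V W (2 * (n + 1 + 1)) y - potV lam nu U V W (2 * (n + 1)) y
      = ψ (n + 1) y - ψ n y := fun n y => by rw [potV_even, potV_even]; simp only [hψ]; ring
  have g0 := M.sys.weight_pos'
  have h0 := M.sys.symm.weight_pos'
  have D0 : ∀ n, 0 ≤ D n := fun n => integral_nonneg fun x => by
    have := g0 x; positivity
  have E0 : ∀ n, 0 ≤ E n := fun n => integral_nonneg fun y => by
    have := h0 y; positivity
  have pO : ∀ n, IsProbabilityMeasure (piOdd lam nu U V W n) := fun n => by
    have := M.isMarkovKernel_transOdd n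
    unfold piOdd; infer_instance
  have pE : ∀ n, IsProbabilityMeasure (piEven lam nu U V W n) := fun n => by
    have := M.isMarkovKernel_transEven n
    unfold piEven; infer_instance
  have dX : ∀ n, _ := fun n => M.sys.wtv_density (hK n).1.toLowerPot (hK (n + 1)).1.meas
    (hK (n + 1)).1.upper (pO n) (by rw [M.piOdd_withDensity]; simp_rw [eφ]; rfl) a0
  have dY : ∀ n, _ := fun n => M.sys.symm.wtv_density (hK n).2.toLowerPot (hK (n + 1)).2.meas
    (hK (n + 1)).2.upper (pE (n + 1)) (by rw [M.piEven_withDensity]; simp_rw [eψ]; rfl) a0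
  have mg : Measurable fun x => 1 / 2 + a * g x :=
    (M.sys.left.meas_weight.const_mul a).const_add _
  have mh : Measurable fun y => 1 / 2 + a * h y :=
    (M.sys.right.meas_weight.const_mul a).const_add _
  have pg : ∀ x, 0 < 1 / 2 + a * g x := fun x => by have := g0 x; positivity
  have ph : ∀ y, 0 < 1 / 2 + a * h y := fun y => by have := h0 y; positivity
  -- The kernel 𝒦_{2n+2} sends π_{2n+1} to η and μ to π_{2n+2}.
  have hED : ∀ n, E n ≤ ϱ * D n := by
    intro n
    have := wtv_bind_le_of_lip_le mg pg (hc (n + 1) (by omega)).1 (dX n).1 (dX n).2.1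
      (by rw [(dX n).2.2.1]; exact ENNReal.ofReal_ne_top)
    rw [M.piOdd_bind, ← piEven, wtv_comm, (dY n).2.2.1, (dX n).2.2.1,
      ← ENNReal.ofReal_mul ϱ0.le, ENNReal.ofReal_le_ofReal_iff (mul_nonneg ϱ0.le (D0 n))] at this
    exact this
  -- The kernel 𝒦_{2n+3} sends π_{2n+2} to μ and η to π_{2n+3}.
  have hDE : ∀ n, D (n + 1) ≤ ϱ * E n := by
    intro n
    have := wtv_bind_le_of_lip_le mh ph (hc (n + 1) (by omega)).2 (dY n).1 (dY n).2.1
      (by rw [(dY n).2.2.1]; exact ENNReal.ofReal_ne_top)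
    rw [M.piEven_bind, ← piOdd, wtv_comm, (dX (n + 1)).2.2.1, (dY n).2.2.1,
      ← ENNReal.ofReal_mul ϱ0.le, ENNReal.ofReal_le_ofReal_iff (mul_nonneg ϱ0.le (E0 n))] at this
    exact this
  have hDn : ∀ n, D n ≤ D 0 * (ϱ ^ 2) ^ n := by
    intro n
    induction n with
    | zero => simp
    | succ n ih =>
      calc D (n + 1) ≤ ϱ * (ϱ * D n) :=
            (hDE n).trans (mul_le_mul_of_nonneg_left (hED n) ϱ0.le)
        _ ≤ ϱ * (ϱ * (D 0 * (ϱ ^ 2) ^ n)) := by gcongr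
        _ = _ := by ring
  obtain ⟨C₁, C₁0, hC₁⟩ := M.sys.exists_abs_lse_sub_le
  obtain ⟨C₂, C₂0, hC₂⟩ := M.sys.symm.exists_abs_lse_sub_le
  obtain ⟨C₃, C₃0, hC₃⟩ := M.sys.exists_abs_le K
  obtain ⟨C₄, C₄0, hC₄⟩ := M.sys.symm.exists_abs_le K
  obtain ⟨C₅, hC₅⟩ := M.abs_le
  have sφ : ∀ n x, |φ (n + 2) x - φ (n + 1) x| ≤ C₁ * (E n / a) * g x := by
    intro n x
    have l₁ := (hK (n + 1)).1.toLowerPot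
    have l₂ := (hK (n + 2)).1.toLowerPot
    have := hC₁ K (ψ n) (ψ (n + 1)) (hK n).2.toLowerPot (hK (n + 1)).2.toLowerPot
      (hK (n + 1)).2.upper (by rw [← I.left]; exact l₁) (by rw [← I.left]; exact l₂) x
    rw [← I.left, ← I.left] at this
    refine this.trans ?_
    have hE' := (dY n).2.2.2
    have := g0 x
    gcongr
    rw [le_div_iff₀ a0, mul_comm]
    exact hE'
  have sψ : ∀ n y, |ψ (n + 1) y - ψ n y| ≤ C₂ * (D n / a) * h y := by
    intro n y
    have l₁ := (hK n).2.toLowerPot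
    have l₂ := (hK (n + 1)).2.toLowerPot
    have := hC₂ K (φ n) (φ (n + 1)) (hK n).1.toLowerPot (hK (n + 1)).1.toLowerPot
      (hK (n + 1)).1.upper (by rw [← I.right]; exact l₁) (by rw [← I.right]; exact l₂) y
    rw [← I.right, ← I.right] at this
    refine this.trans ?_
    have hD' := (dX n).2.2.2
    have := h0 y
    gcongr
    rw [le_div_iff₀ a0, mul_comm]
    exact hD'
  -- The entries with `D 0` pay for the index shift between distances and increments, by one factor
  -- `ϱ` on `X` and two on `Y`. The other entries bound the first increments.
  set A := max (max (C₁ * D 0 / (ϱ * a)) (C₃ + C₃)) (max (C₂ * D 0 / (ϱ ^ 2 * a)) (|C₅| + C₄))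
    with hA
  have A₁ : C₁ * D 0 / (ϱ * a) ≤ A := (le_max_left _ _).trans (le_max_left _ _)
  have A₂ : C₃ + C₃ ≤ A := (le_max_right _ _).trans (le_max_left _ _)
  have A₃ : C₂ * D 0 / (ϱ ^ 2 * a) ≤ A := (le_max_left _ _).trans (le_max_right _ _)
  have A₄ : |C₅| + C₄ ≤ A := (le_max_right _ _).trans (le_max_right _ _)
  refine ⟨A, (by positivity : 0 < C₃ + C₃).trans_le A₂, fun n => ⟨fun x => ?_, fun y => ?_⟩⟩
  · rw [eφ]
    have gx := g0 x
    cases n with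
    | zero =>
      have h1 := hC₃ _ (hK 0).1.toLowerPot (hK 0).1.upper x
      have h2 := hC₃ _ (hK 1).1.toLowerPot (hK 1).1.upper x
      rw [pow_zero, mul_one]
      calc _ ≤ |φ (0 + 1) x| + |φ 0 x| := abs_sub _ _
        _ ≤ C₃ * g x + C₃ * g x := add_le_add h2 h1
        _ = (C₃ + C₃) * g x := by ring
        _ ≤ _ := by gcongr
    | succ n =>
      refine (sφ n x).trans ?_
      calc C₁ * (E n / a) * g x ≤ C₁ * (ϱ * (D 0 * (ϱ ^ 2) ^ n) / a) * g x := by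
            gcongr
            exact (hED n).trans (mul_le_mul_of_nonneg_left (hDn n) ϱ0.le)
        _ = (C₁ * D 0 / (ϱ * a)) * g x * (ϱ ^ 2) ^ (n + 1) := by
            field_simp; ring
        _ ≤ _ := by gcongr
  · have hy := h0 y
    cases n with
    | zero =>
      have h1 := hC₄ _ (hK 0).2.toLowerPot (hK 0).2.upper y
      have h2 := hC₅ y
      rw [pow_zero, mul_one, potV_even]
      -- Since V_0 = 0, the first increment on `Y` contains `V` itself; this is the role of the
      -- field `abs_le` of `Model`.
      have e : potV lam nu U V W (2 * 0 + 1) y - potV lam nu U V W (2 * 0) y = V y + ψ 0 y := by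
        simp [hψ, potV, pot]
      rw [e]
      calc _ ≤ |V y| + |ψ 0 y| := abs_add_le _ _
        _ ≤ |C₅| * h y + C₄ * h y :=
          add_le_add (h2.trans (mul_le_mul_of_nonneg_right (le_abs_self _) hy.le)) h1
        _ = (|C₅| + C₄) * h y := by ring
        _ ≤ _ := by gcongr
    | succ n =>
      rw [eψ]
      refine (sψ n y).trans ?_
      calc C₂ * (D n / a) * h y ≤ C₂ * (D 0 * (ϱ ^ 2) ^ n / a) * h y := by
            gcongr
            exact hDn n
        _ = (C₂ * D 0 / (ϱ ^ 2 * a)) * h y * (ϱ ^ 2) ^ (n + 1) := by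
            field_simp; ring
        _ ≤ _ := by gcongr

end Kernels

lemma Model.limU_eq (M : Model lam nu U V W g h k) (x : X) : limU lam nu U V W x =
    potU lam nu U V W (2 * 0) x - ∑' l : ℕ, (potU lam nu U V W (2 * l) x
      - potU lam nu U V W (2 * (l + 1)) x) := by
  unfold limU
  simp_rw [M.ratioX_eq, Real.log_exp]

lemma Model.limV_eq (M : Model lam nu U V W g h k) (y : Y) : limV lam nu U V W y =
    potV lam nu U V W (2 * 0) y - ∑' l : ℕ, (potV lam nu U V W (2 * l) y
      - potV lam nu U V W (2 * (l + 1)) y) := by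
  unfold limV
  simp_rw [M.ratioY_eq, Real.log_exp]

/-- Geometric decay of the increments of the Sinkhorn potentials. -/
structure Decays (lam : Measure X) (nu : Measure Y) (U : X → ℝ) (V : Y → ℝ) (W : X → Y → ℝ)
    (g : X → ℝ) (h : Y → ℝ) (C r : ℝ) : Prop where
  const_pos : 0 < C
  rate_nonneg : 0 ≤ r
  rate_lt_one : r < 1
  left : ∀ n x, |potU lam nu U V W (2 * (n + 1)) x - potU lam nu U V W (2 * n) x|
    ≤ C * g x * r ^ n
  right : ∀ n y, |potV lam nu U V W (2 * (n + 1)) y - potV lam nu U V W (2 * n) y|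
    ≤ C * h y * r ^ n

variable {C r : ℝ}

lemma Decays.tendsto_limU (d : Decays lam nu U V W g h C r) (M : Model lam nu U V W g h k) (x : X) :
    Filter.Tendsto (fun n => potU lam nu U V W (2 * n) x) Filter.atTop
      (𝓝 (limU lam nu U V W x)) ∧
    ∀ n, |limU lam nu U V W x - potU lam nu U V W (2 * n) x| ≤ C * r ^ n / (1 - r) * g x := by
  rw [M.limU_eq]
  obtain ⟨t, e⟩ := geometric_limit (a := fun n => potU lam nu U V W (2 * n) x) d.rate_nonneg
    d.rate_lt_one (fun n => d.left n x)
  exact ⟨t, fun n => (e n).trans_eq (by ring)⟩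

lemma Decays.tendsto_limV (d : Decays lam nu U V W g h C r) (M : Model lam nu U V W g h k) (y : Y) :
    Filter.Tendsto (fun n => potV lam nu U V W (2 * n) y) Filter.atTop
      (𝓝 (limV lam nu U V W y)) ∧
    ∀ n, |limV lam nu U V W y - potV lam nu U V W (2 * n) y| ≤ C * r ^ n / (1 - r) * h y := by
  rw [M.limV_eq]
  obtain ⟨t, e⟩ := geometric_limit (a := fun n => potV lam nu U V W (2 * n) y) d.rate_nonneg
    d.rate_lt_one (fun n => d.right n y)
  exact ⟨t, fun n => (e n).trans_eq (by ring)⟩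

lemma tsum_wnorm_lt_top {Z : Type*} {g : Z → ℝ} (g0 : ∀ z, 0 < g z) {f : ℕ → Z → ℝ} {C r : ℝ}
    (C0 : 0 ≤ C) (r0 : 0 ≤ r) (r1 : r < 1) (hf : ∀ n z, |f n z| ≤ C * g z * r ^ n) :
    ∑' n, wnorm g (f n) < ∞ := by
  have hs : Summable fun n : ℕ => C * r ^ n := (summable_geometric_of_lt_one r0 r1).mul_left C
  have : ∑' n, ENNReal.ofReal (C * r ^ n) < ∞ := by
    rw [← ENNReal.ofReal_tsum_of_nonneg (fun n => by positivity) hs]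
    exact ENNReal.ofReal_lt_top
  refine (ENNReal.tsum_le_tsum fun n => ?_).trans_lt this
  exact wnorm_le g0 fun z => (hf n z).trans_eq (by ring)

lemma Decays.tsum_ratioX (d : Decays lam nu U V W g h C r) (M : Model lam nu U V W g h k) :
    ∑' l : ℕ, wnorm g (fun x => Real.log (ratioX lam nu U V W l x)) < ∞ :=
  tsum_wnorm_lt_top M.sys.weight_pos' d.const_pos.le d.rate_nonneg d.rate_lt_one fun n x => by
    rw [M.ratioX_eq, Real.log_exp, abs_sub_comm]; exact d.left n x

lemma Decays.tsum_ratioY (d : Decays lam nu U V W g h C r) (M : Model lam nu U V W g h k) :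
    ∑' l : ℕ, wnorm h (fun y => Real.log (ratioY lam nu U V W l y)) < ∞ :=
  tsum_wnorm_lt_top M.sys.symm.weight_pos' d.const_pos.le d.rate_nonneg d.rate_lt_one
    fun n y => by rw [M.ratioY_eq, Real.log_exp, abs_sub_comm]; exact d.right n y

/-- Both sides of the iteration converge at every point, so the limiting equation holds everywhere
and not only almost everywhere. -/
lemma Decays.schrodinger_left (d : Decays lam nu U V W g h C r) (M : Model lam nu U V W g h k) :
    LogOp nu W (limV lam nu U V W) (fun x => limU lam nu U V W x - U x) := by
  obtain ⟨K, _, hK⟩ := M.exists_adm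
  obtain ⟨l, t⟩ := M.sys.tendsto_lse (fun n => (hK n).2.toLowerPot)
    (ψ' := fun y => limV lam nu U V W y - V y) fun y => by
      have := (((d.tendsto_limV M y).1.comp (Filter.tendsto_add_atTop_nat 1))).sub_const (V y)
      refine this.congr fun n => ?_
      simp only [Function.comp, potV_even]
  convert! logOp_of_lowerPot M.sys M.measV l using 1
  funext x
  refine tendsto_nhds_unique ?_ (t x)
  have := (((d.tendsto_limU M x).1.comp (Filter.tendsto_add_atTop_nat 1))).sub_const (U x)
  refine this.congr fun n => ?_
  exact congrFun ((iter_pot M).left n) x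

lemma Decays.schrodinger_right (d : Decays lam nu U V W g h C r) (M : Model lam nu U V W g h k) :
    LogOp lam (flat W) (limU lam nu U V W) (fun y => limV lam nu U V W y - V y) := by
  obtain ⟨K, _, hK⟩ := M.exists_adm
  obtain ⟨l, t⟩ := M.sys.symm.tendsto_lse (fun n => (hK n).1.toLowerPot)
    (ψ' := fun x => limU lam nu U V W x - U x) fun x => (d.tendsto_limU M x).1.sub_const (U x)
  convert! logOp_of_lowerPot M.sys.symm M.measU l using 1
  funext y
  refine tendsto_nhds_unique ?_ (t y)
  have := (((d.tendsto_limV M y).1.comp (Filter.tendsto_add_atTop_nat 1))).sub_const (V y)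
  refine this.congr fun n => ?_
  simp only [Function.comp, potV_even]
  exact congrFun ((iter_pot M).right n) y

lemma LogOp.eq_add_log {v : Y → ℝ} {u : X → ℝ} (H : LogOp nu W v fun x => u x - U x) (x : X) :
    u x = U x + Real.log (op W nu (fun y => Real.exp (-v y)) x) := by
  rw [← H.exp_eq, Real.log_exp]; ring

lemma Decays.integrable_left (d : Decays lam nu U V W g h C r) (M : Model lam nu U V W g h k)
    (n : ℕ) : Integrable (fun x => potU lam nu U V W (2 * n) x - limU lam nu U V W x)
      (gibbs lam U) ∧
    ∫ x, (potU lam nu U V W (2 * n) x - limU lam nu U V W x) ∂(gibbs lam U)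
      ≤ C * r ^ n / (1 - r) * ∫ x, g x ∂(gibbs lam U) := by
  have b : ∀ x, |potU lam nu U V W (2 * n) x - limU lam nu U V W x|
      ≤ C * r ^ n / (1 - r) * g x := fun x => by
    rw [abs_sub_comm]; exact (d.tendsto_limU M x).2 n
  have ig := M.sys.integrable_weight.const_mul (C * r ^ n / (1 - r))
  have i : Integrable (fun x => potU lam nu U V W (2 * n) x - limU lam nu U V W x)
      (gibbs lam U) := ig.mono' (measurable_fun_sub (M.measurable_potU n)
        (d.schrodinger_right M).meas_right).aestronglyMeasurable (ae_of_all _ b)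
  refine ⟨i, ?_⟩
  rw [← integral_const_mul]
  exact integral_mono i ig fun x => (le_abs_self _).trans (b x)

lemma Decays.integrable_right (d : Decays lam nu U V W g h C r) (M : Model lam nu U V W g h k)
    (n : ℕ) : Integrable (fun y => potV lam nu U V W (2 * n) y - limV lam nu U V W y)
      (gibbs nu V) ∧
    ∫ y, (potV lam nu U V W (2 * n) y - limV lam nu U V W y) ∂(gibbs nu V)
      ≤ C * r ^ n / (1 - r) * ∫ y, h y ∂(gibbs nu V) := by
  have b : ∀ y, |potV lam nu U V W (2 * n) y - limV lam nu U V W y|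
      ≤ C * r ^ n / (1 - r) * h y := fun y => by
    rw [abs_sub_comm]; exact (d.tendsto_limV M y).2 n
  have ih := M.sys.symm.integrable_weight.const_mul (C * r ^ n / (1 - r))
  have i : Integrable (fun y => potV lam nu U V W (2 * n) y - limV lam nu U V W y)
      (gibbs nu V) := ih.mono' (measurable_fun_sub (M.measurable_potV n)
        (d.schrodinger_left M).meas_right).aestronglyMeasurable (ae_of_all _ b)
  refine ⟨i, ?_⟩
  rw [← integral_const_mul]
  exact integral_mono i ih fun y => (le_abs_self _).trans (b y)

variable [SFinite nu]

lemma Model.isProbabilityMeasure_bridgeEven (M : Model lam nu U V W g h k) (n : ℕ) :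
    IsProbabilityMeasure (bridgeEven lam nu U V W n) := by
  have := M.sys.prob_left
  have := M.isMarkovKernel_transEven n
  unfold bridgeEven; infer_instance

variable [SFinite lam]

/-- The two Schrödinger equations say that the normalizations are 𝕌 - U and 𝕍 - V, so the marginals
reduce to the Gibbs measures of `U` and `V`. -/
lemma Decays.isCoupling (d : Decays lam nu U V W g h C r) (M : Model lam nu U V W g h k) :
    IsCoupling (gibbs lam U) (gibbs nu V)
      (joint lam nu W (limU lam nu U V W) (limV lam nu U V W)) := by
  have L := d.schrodinger_left M
  have R := d.schrodinger_right M
  constructor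
  · rw [joint_fst M.sys.meas_cost L R.meas_right]; simp
  · rw [joint_snd M.sys.meas_cost R L.meas_right]; simp

lemma Decays.joint_eq (d : Decays lam nu U V W g h C r) (M : Model lam nu U V W g h k) (n : ℕ) :
    joint lam nu W (limU lam nu U V W) (limV lam nu U V W)
      = (bridgeEven lam nu U V W n).withDensity fun p => ENNReal.ofReal (Real.exp
        ((potU lam nu U V W (2 * n) p.1 - limU lam nu U V W p.1)
          + (potV lam nu U V W (2 * n) p.2 - limV lam nu U V W p.2))) := by
  rw [M.bridgeEven_eq]
  exact joint_withDensity M.sys.meas_cost (M.measurable_potU n) (M.measurable_potV n)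
    (d.schrodinger_right M).meas_right (d.schrodinger_left M).meas_right

/-- The log-density relative to 𝒫_{2n} splits over the coordinates, so its integral sees only μ and
η and is linear in the errors of the potentials. -/
lemma Decays.klDiv_le (d : Decays lam nu U V W g h C r) (M : Model lam nu U V W g h k) (n : ℕ) :
    InformationTheory.klDiv (joint lam nu W (limU lam nu U V W) (limV lam nu U V W))
      (bridgeEven lam nu U V W n) ≤ ENNReal.ofReal (C * r ^ n / (1 - r) *
        (∫ x, g x ∂(gibbs lam U) + ∫ y, h y ∂(gibbs nu V))) := by
  have := M.sys.prob_left
  have hQ := d.isCoupling M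
  have := hQ.isProbabilityMeasure
  have := M.isProbabilityMeasure_bridgeEven n
  obtain ⟨i, e⟩ := hQ.integral_add (d.integrable_left M n).1 (d.integrable_right M n).1
  rw [klDiv_withDensity_exp (((measurable_fun_sub (M.measurable_potU n)
    (d.schrodinger_right M).meas_right).comp measurable_fst).add
    ((measurable_fun_sub (M.measurable_potV n) (d.schrodinger_left M).meas_right).comp
      measurable_snd)) (d.joint_eq M n) i]
  refine ENNReal.ofReal_le_ofReal (e.le.trans ?_)
  rw [mul_add]
  exact add_le_add (d.integrable_left M n).2 (d.integrable_right M n).2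

lemma Decays.isSchrodingerBridge (d : Decays lam nu U V W g h C r)
    (M : Model lam nu U V W g h k) :
    IsSchrodingerBridge (bridgeEven lam nu U V W 0) (gibbs lam U) (gibbs nu V)
      (joint lam nu W (limU lam nu U V W) (limV lam nu U V W)) ∧
    ∀ R, IsSchrodingerBridge (bridgeEven lam nu U V W 0) (gibbs lam U) (gibbs nu V) R →
      R = joint lam nu W (limU lam nu U V W) (limV lam nu U V W) := by
  have := M.sys.prob_left
  have := M.isProbabilityMeasure_bridgeEven 0
  exact isSchrodingerBridge_of_density
    (measurable_fun_sub (M.measurable_potU 0) (d.schrodinger_right M).meas_right)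
    (measurable_fun_sub (M.measurable_potV 0) (d.schrodinger_left M).meas_right)
    (d.integrable_left M 0).1 (d.integrable_right M 0).1 (d.isCoupling M) (d.joint_eq M 0)

end Convergence

/-! ### Reduction of the hypotheses to the normalized model -/

lemma abs_le_exp_mul {t M δ : ℝ} (δ0 : 0 < δ) (M0 : 0 ≤ M) (ht : -M ≤ t) :
    |t| ≤ (M / Real.exp (δ * -M) + 1 / δ) * Real.exp (δ * t) := by
  have h1 : M ≤ M / Real.exp (δ * -M) * Real.exp (δ * t) := by
    rw [div_mul_eq_mul_div, le_div_iff₀ (Real.exp_pos _)]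
    exact mul_le_mul_of_nonneg_left (Real.exp_le_exp.2 (mul_le_mul_of_nonneg_left ht δ0.le)) M0
  have h2 : t ≤ 1 / δ * Real.exp (δ * t) := by
    rw [one_div_mul_eq_div, le_div_iff₀ δ0]
    linarith [Real.add_one_le_exp (δ * t)]
  have h3 : 0 ≤ 1 / δ * Real.exp (δ * t) := by positivity
  rw [add_mul]
  exact abs_le.2 ⟨by linarith, by linarith⟩

lemma exists_model {X Y : Type*}
    [TopologicalSpace X] [T2Space X] [MeasurableSpace X] [BorelSpace X]
    [TopologicalSpace Y] [T2Space Y] [MeasurableSpace Y] [BorelSpace Y]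
    {lam : Measure X} {nu : Measure Y} {U : X → ℝ} {V : Y → ℝ} {W : X → Y → ℝ}
    (hμ : IsProbabilityMeasure (gibbs lam U)) (hη : IsProbabilityMeasure (gibbs nu V))
    (hWm : Measurable (Function.uncurry W))
    (hK : ∀ x, ∫⁻ y, ENNReal.ofReal (Real.exp (-W x y)) ∂nu = 1)
    (hU : LocallyBounded U) (hV : LocallyBounded V) (hW : LocallyBounded (Function.uncurry W))
    (hWb : ∃ C : ℝ, ∀ x y, Real.exp (-W x y) ≤ C)
    (hUc : CompactSublevels U) (hVc : CompactSublevels V) {δ : ℝ}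
    (hA : ConditionA lam nu U V W δ) :
    ∃ k, Model lam nu U V W (fun x => Real.exp (δ * U x)) (fun y => Real.exp (δ * V y)) k := by
  obtain ⟨C, hC⟩ := hWb
  obtain ⟨δ0, -, iU, iV, iWV, iWU, ⟨θu, hθu, hu⟩, ⟨θv, hθv, hv⟩⟩ := hA
  have hWf : LocallyBounded (Function.uncurry (flat W)) := by
    rintro ⟨y, x⟩
    obtain ⟨s, hs, B, hB⟩ := hW (x, y)
    exact ⟨Prod.swap ⁻¹' s, continuous_swap.continuousAt.preimage_mem_nhds hs, B,
      fun w hw => hB w.swap hw⟩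
  obtain ⟨B, B0, hB⟩ := hV.exists_lower_bound hVc
  -- The bound on e^{-W} becomes -W ≤ log C; the maximum makes `k` nonnegative.
  refine ⟨max 0 (Real.log C), ⟨⟨hμ, hη, hWm, le_max_left _ _, fun x y => ?_, ?_, ?_⟩,
    hUc.measurable, hVc.measurable, hK, ⟨_, fun y => abs_le_exp_mul δ0 B0 (hB y)⟩⟩⟩
  · have := Real.log_le_log (Real.exp_pos _) (hC x y)
    rw [Real.log_exp] at this
    exact this.trans (le_max_right _ _)
  · exact halfSys_of_lyapunov hη hU hW hUc hVc δ0 iU iWV hθu hu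
  · exact halfSys_of_lyapunov hμ hV hWf hVc hUc δ0 iV iWU hθv hv

end Sinkhorn

end

/-! ### Assembly of the theorem -/

theorem mainTheorem3
    {X Y : Type*}
    [TopologicalSpace X] [PolishSpace X] [LocallyCompactSpace X] [MeasurableSpace X] [BorelSpace X]
    [TopologicalSpace Y] [PolishSpace Y] [LocallyCompactSpace Y] [MeasurableSpace Y] [BorelSpace Y]
    (lam : Measure X) [IsLocallyFiniteMeasure lam]
    (nu : Measure Y) [IsLocallyFiniteMeasure nu]
    (U : X → ℝ) (V : Y → ℝ) (W : X → Y → ℝ)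
    -- the marginals and the reference transition
    (hμ : IsProbabilityMeasure (Sinkhorn.gibbs lam U))
    (hη : IsProbabilityMeasure (Sinkhorn.gibbs nu V))
    (hWm : Measurable (Function.uncurry W))
    (hK : ∀ x, ∫⁻ y, ENNReal.ofReal (Real.exp (-W x y)) ∂nu = 1)
    -- regularity of the potentials
    (hU : Sinkhorn.LocallyBounded U) (hV : Sinkhorn.LocallyBounded V)
    (hW : Sinkhorn.LocallyBounded (Function.uncurry W))
    (hWb : ∃ C : ℝ, ∀ x y, Real.exp (-W x y) ≤ C)
    (hUc : Sinkhorn.CompactSublevels U) (hVc : Sinkhorn.CompactSublevels V)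
    -- the Lyapunov condition
    (δ : ℝ) (hA : Sinkhorn.ConditionA lam nu U V W δ) :
    -- the transitions are those of the Sinkhorn algorithm, and the log-ratios are logarithms of
    -- versions of the Radon-Nikodym derivatives
    Sinkhorn.BayesRecursion lam nu U V W ∧
    (∀ n : ℕ,
      Sinkhorn.gibbs nu V = (Sinkhorn.piEven lam nu U V W n).withDensity
        (fun y => ENNReal.ofReal (Sinkhorn.ratioY lam nu U V W n y)) ∧
      Sinkhorn.gibbs lam U = (Sinkhorn.piOdd lam nu U V W n).withDensity
        (fun x => ENNReal.ofReal (Sinkhorn.ratioX lam nu U V W n x))) ∧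
    -- the series that define the limits converge absolutely in the weighted norms
    (∑' l : ℕ, Sinkhorn.wnorm (fun x => Real.exp (δ * U x))
      (fun x => Real.log (Sinkhorn.ratioX lam nu U V W l x)) < ∞) ∧
    (∑' l : ℕ, Sinkhorn.wnorm (fun y => Real.exp (δ * V y))
      (fun y => Real.log (Sinkhorn.ratioY lam nu U V W l y)) < ∞) ∧
    -- the limits solve the Schrödinger system
    (∀ x, Sinkhorn.limU lam nu U V W x = U x + Real.log
      (Sinkhorn.op W nu (fun y => Real.exp (-Sinkhorn.limV lam nu U V W y)) x)) ∧
    (∀ y, Sinkhorn.limV lam nu U V W y = V y + Real.log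
      (Sinkhorn.op (Sinkhorn.flat W) lam
        (fun x => Real.exp (-Sinkhorn.limU lam nu U V W x)) y)) ∧
    -- the uniform contraction property holds for some parameters
    (∃ a ϱ : ℝ, 0 < a ∧ 0 < ϱ ∧ ϱ < 1 ∧ Sinkhorn.UniformContraction lam nu U V W δ a ϱ) ∧
    -- the Schrödinger bridge exists, is unique, has potentials `limU`, `limV`, and the
    -- exponential estimates hold with any contraction rate
    ∃ Q : Measure (X × Y),
      Sinkhorn.IsSchrodingerBridge
        ((Sinkhorn.gibbs lam U).compProd (Sinkhorn.refKernel W nu))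
        (Sinkhorn.gibbs lam U) (Sinkhorn.gibbs nu V) Q ∧
      (∀ R : Measure (X × Y), Sinkhorn.IsSchrodingerBridge
        ((Sinkhorn.gibbs lam U).compProd (Sinkhorn.refKernel W nu))
        (Sinkhorn.gibbs lam U) (Sinkhorn.gibbs nu V) R → R = Q) ∧
      Q = (lam.prod nu).withDensity (fun p => ENNReal.ofReal (Real.exp
        (-Sinkhorn.limU lam nu U V W p.1 - W p.1 p.2 - Sinkhorn.limV lam nu U V W p.2))) ∧
      ∀ a ϱ : ℝ, 0 < a → 0 < ϱ → ϱ < 1 → Sinkhorn.UniformContraction lam nu U V W δ a ϱ →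
        ∃ c : ℝ, 0 < c ∧ ∀ n : ℕ, 1 ≤ n →
          Sinkhorn.wnorm (fun x => Real.exp (δ * U x))
            (fun x => Sinkhorn.limU lam nu U V W x - Sinkhorn.potU lam nu U V W (2 * n) x)
            ≤ ENNReal.ofReal (c * ϱ ^ (2 * n)) ∧
          Sinkhorn.wnorm (fun y => Real.exp (δ * V y))
            (fun y => Sinkhorn.limV lam nu U V W y - Sinkhorn.potV lam nu U V W (2 * n) y)
            ≤ ENNReal.ofReal (c * ϱ ^ (2 * n)) ∧
          InformationTheory.klDiv Q (Sinkhorn.bridgeEven lam nu U V W n)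
            ≤ ENNReal.ofReal (c * ϱ ^ (2 * n)) := by
  obtain ⟨k, M⟩ := Sinkhorn.exists_model hμ hη hWm hK hU hV hW hWb hUc hVc hA
  have decays : ∀ a ϱ : ℝ, 0 < a → 0 < ϱ → ϱ < 1 →
      Sinkhorn.UniformContraction lam nu U V W δ a ϱ → ∃ C, Sinkhorn.Decays lam nu U V W
        (fun x => Real.exp (δ * U x)) (fun y => Real.exp (δ * V y)) C (ϱ ^ 2) := by
    intro a ϱ a0 ϱ0 ϱ1 hc
    obtain ⟨C, C0, hC⟩ := M.exists_decay a0 ϱ0 hc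
    exact ⟨C, C0, by positivity, pow_lt_one₀ ϱ0.le ϱ1 two_ne_zero, fun n => (hC n).1,
      fun n => (hC n).2⟩
  -- The limits do not depend on (a, ϱ): one admissible pair gives convergence and the bridge, and
  -- any other pair only changes the rate.
  obtain ⟨a, ϱ, a0, ϱ0, ϱ1, hc⟩ := M.exists_contractsWith
  obtain ⟨C, d⟩ := decays a ϱ a0 ϱ0 ϱ1 hc
  have B := M.bayesRecursion
  refine ⟨B, fun n => ⟨M.gibbs_eq_piEven_withDensity n, M.gibbs_eq_piOdd_withDensity n⟩,
    d.tsum_ratioX M, d.tsum_ratioY M, (d.schrodinger_left M).eq_add_log,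
    (d.schrodinger_right M).eq_add_log, ⟨a, ϱ, a0, ϱ0, ϱ1, hc⟩,
    Sinkhorn.joint lam nu W (Sinkhorn.limU lam nu U V W) (Sinkhorn.limV lam nu U V W), ?_, ?_,
    rfl, ?_⟩
  · rw [← B.1]; exact (d.isSchrodingerBridge M).1
  · rw [← B.1]; exact (d.isSchrodingerBridge M).2
  · intro a ϱ a0 ϱ0 ϱ1 hc
    obtain ⟨C, d⟩ := decays a ϱ a0 ϱ0 ϱ1 hc
    set I := ∫ x, Real.exp (δ * U x) ∂(Sinkhorn.gibbs lam U)
      + ∫ y, Real.exp (δ * V y) ∂(Sinkhorn.gibbs nu V) with hI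
    have I0 : 0 ≤ I := add_nonneg (integral_nonneg fun _ => (Real.exp_pos _).le)
      (integral_nonneg fun _ => (Real.exp_pos _).le)
    have C0 := d.const_pos
    have r1 : 0 < 1 - ϱ ^ 2 := sub_pos.2 d.rate_lt_one
    -- The factor C / (1 - ϱ²) comes from the geometric tail; in 1 + I the 1 serves the sup norms
    -- and `I` the entropy.
    refine ⟨C / (1 - ϱ ^ 2) * (1 + I), by positivity, fun n _ => ?_⟩
    have e : ∀ t : ℝ, C * (ϱ ^ 2) ^ n / (1 - ϱ ^ 2) * t
        = C / (1 - ϱ ^ 2) * ϱ ^ (2 * n) * t := fun t => by rw [pow_mul]; ring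
    have le₁ : C / (1 - ϱ ^ 2) * ϱ ^ (2 * n) ≤ C / (1 - ϱ ^ 2) * (1 + I) * ϱ ^ (2 * n) := by
      have : 0 ≤ C / (1 - ϱ ^ 2) * ϱ ^ (2 * n) * I := by positivity
      linarith
    refine ⟨?_, ?_, ?_⟩
    · refine (Sinkhorn.wnorm_le (fun x => Real.exp_pos _) fun x =>
        ((d.tendsto_limU M x).2 n).trans_eq (e _)).trans (ENNReal.ofReal_le_ofReal le₁)
    · refine (Sinkhorn.wnorm_le (fun y => Real.exp_pos _) fun y =>
        ((d.tendsto_limV M y).2 n).trans_eq (e _)).trans (ENNReal.ofReal_le_ofReal le₁)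
    · refine (d.klDiv_le M n).trans (ENNReal.ofReal_le_ofReal ?_)
      rw [e, ← hI]
      have : 0 ≤ C / (1 - ϱ ^ 2) * ϱ ^ (2 * n) := by positivity
      linarith
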